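/- **Setting.** All manifolds are finite-dimensional, without boundary and $C^\infty$; all objects are $C^\infty$. A *discrete tangent bundle* of a manifold $Q$ is a manifold $\mathcal V$ with $\dim\mathcal V=2\dim Q$ and two submersions $\partial^+,\partial^-:\mathcal V\to Q$ such that $\ker T\partial^+\cap\ker T\partial^-=0$ and, for every $q\in Q$, $(\partial^+)^{-1}(q)\cap(\partial^-)^{-1}(q)$ is exactly one point. Then $T\mathcal V=\ker T\partial^-\oplus\ker T\partial^+$, and for $\delta v\in T_v\mathcal V$ we write $\delta v=\delta v^++\delta v^-$ with $\delta v^+\in\ker T_v\partial^-$ and $\delta v^-\in\ker T_v\partial^+$. A *discrete constrained Lagrangian system* $(\mathcal V,\sigma_d,\mathcal D_d,\mathcal E_d)$ consists of a discrete tangent bundle $\mathcal V$ of $Q$, a one-form $\sigma_d$ on $\mathcal V$ (not necessarily closed), a submanifold $\mathcal D_d\subseteq\mathcal V$ on which $\partial^+$ and $\partial^-$ restrict to submersions, and a subbundle $\mathcal E_d$ of $(\partial^+|\mathcal D_d)^*(TQ)$, i.e. a smooth assignment of subspaces $(\mathcal E_d)_v\subseteq T_{\partial^+(v)}Q$ to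 $v\in\mathcal D_d$. A pair $(v,\tilde v)\in\mathcal D_d\times\mathcal D_d$ is a *solution pair* if $\partial^+(v)=\partial^-(\tilde v)$ and $\sigma_d(v)\,\delta v+\sigma_d(\tilde v)\,\delta\tilde v=0$ for all $\delta v\in T_v\mathcal V$, $\delta\tilde v\in T_{\tilde v}\mathcal V$ with $T\partial^+(\delta v)=T\partial^-(\delta\tilde v)$, $T\partial^-(\delta v)=0$, $T\partial^+(\delta\tilde v)=0$ and $T\partial^+(\delta v)\in(\mathcal E_d)_v$. An *evolution map* is a smooth map $F:U_F\to\mathcal D_d$, $U_F$ open in $\mathcal D_d$, such that $(v,F(v))$ is a solution pair for every $v\in U_F$. Define one-forms on $\mathcal V$ by $\theta^+(v)\,\delta v=\sigma_d(v)\,\delta v^+$ and $\theta^-(v)\,\delta v=-\sigma_d(v)\,\delta v^-$, and two-forms $\omega^\pm=-d\theta^\pm$. Let $$\mathcal K^+=\{\delta v\in T_v\mathcal D_d : v\in\mathcal D_d,\ T\partial^+(\delta v)\in(\mathcal E_d)_v\},$$ a distribution on $\mathcal D_d$, with curvature two-form $\Delta_{\mathcal K^+}$ given on vector fields $X,Y$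 with values in $\mathcal K^+$ by $\Delta_{\mathcal K^+}(X,Y)=-\nu[X,Y]$, where $\nu$ is the quotient map by $\mathcal K^+$. **Theorem.** Let $(\mathcal V,\sigma_d,\mathcal D_d,\mathcal E_d)$ be a discrete constrained Lagrangian system with an evolution map $F:U_F\to\mathcal D_d$, and let $\mathcal K_d^0$ be a smooth subbundle of $\mathcal K^+$ over a subset $\mathcal D_d^0\subseteq\mathcal D_d$. Suppose that 1. $\mathcal K_d^0$ is $TF$-invariant: if $v\in\mathcal D_d^0\cap U_F$, then $F(v)\in\mathcal D_d^0$ and $TF\bigl((\mathcal K_d^0)_v\bigr)\subseteq(\mathcal K_d^0)_{F(v)}$; 2. $\Delta_{\mathcal K^+}(\delta v,\delta w)=0$ for all $v\in\mathcal D_d^0$ and $\delta v,\delta w\in(\mathcal K_d^0)_v$; 3. $d\sigma_d(v)(\delta v,\delta w)=0$ for all $v\in\mathcal D_d^0$ and $\delta v,\delta w\in(\mathcal K_d^0)_v$. Then $\omega^+=\omega^-$ on $\mathcal K_d^0$, and $F$ preserves this common form $\omega_{\sigma_d}$ on $\mathcal K_d^0$: first, $\omega^+(v)(\delta v,\delta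 w)=\omega^-(v)(\delta v,\delta w)$ for all $v\in\mathcal D_d^0$ and $\delta v,\delta w\in(\mathcal K_d^0)_v$; second, for all $v\in\mathcal D_d^0\cap U_F$, all $\delta v,\delta w\in(\mathcal K_d^0)_v$ and each choice of sign, $$\omega^\pm\bigl(F(v)\bigr)\bigl(TF\,\delta v,TF\,\delta w\bigr)=\omega^\pm(v)(\delta v,\delta w).$$ -/

import Mathlib

open scoped Manifold ContDiff Topology

namespace DiscreteLagrange

noncomputable section

/-! ### Differential geometry: subbundles, exterior derivative, curvature

All manifolds are finite-dimensional, smooth and without boundary, modelled on a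
finite-dimensional real normed space `E` through the identity model `𝓘(ℝ, E)`. -/

/-- The derivative of a submersion is onto. -/
theorem surjective_mfderiv_of_isSubmersionAt
    {E E' : Type*} [NormedAddCommGroup E] [NormedSpace ℝ E]
    [NormedAddCommGroup E'] [NormedSpace ℝ E']
    {M N : Type*} [TopologicalSpace M] [ChartedSpace E M] [IsManifold 𝓘(ℝ, E) ∞ M]
    [TopologicalSpace N] [ChartedSpace E' N] [IsManifold 𝓘(ℝ, E') ∞ N]
    {f : M → N} {x : M} (h : Manifold.IsSubmersionAt 𝓘(ℝ, E) 𝓘(ℝ, E') ∞ f x) :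
    Function.Surjective (mfderiv 𝓘(ℝ, E) 𝓘(ℝ, E') f x) := by
  obtain ⟨F, _, _, h⟩ := h
  have hf : MDifferentiableAt 𝓘(ℝ, E) 𝓘(ℝ, E') f x := h.contMDiffAt.mdifferentiableAt (by simp)
  have hφ : h.domChart.MDifferentiable 𝓘(ℝ, E) 𝓘(ℝ, E) :=
    ⟨(contMDiffOn_of_mem_maximalAtlas h.domChart_mem_maximalAtlas).mdifferentiableOn (by simp),
     (contMDiffOn_symm_of_mem_maximalAtlas h.domChart_mem_maximalAtlas).mdifferentiableOn
      (by simp)⟩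
  have hψ : h.codChart.MDifferentiable 𝓘(ℝ, E') 𝓘(ℝ, E') :=
    ⟨(contMDiffOn_of_mem_maximalAtlas h.codChart_mem_maximalAtlas).mdifferentiableOn (by simp),
     (contMDiffOn_symm_of_mem_maximalAtlas h.codChart_mem_maximalAtlas).mdifferentiableOn
      (by simp)⟩
  have hx := h.mem_domChart_source
  have hy := h.mem_codChart_source
  set L : E →L[ℝ] E' :=
    (ContinuousLinearMap.fst ℝ E' F).comp (h.equiv : E →L[ℝ] E' × F) with hL
  have hLs : Function.Surjective L := by
    intro y
    exact ⟨h.equiv.symm (y, 0), by simp [hL]⟩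
  have heq : h.codChart ∘ f =ᶠ[𝓝 x] L ∘ h.domChart := by
    filter_upwards [h.domChart.open_source.mem_nhds hx] with y hy
    have hm : h.domChart y ∈ (h.domChart.extend 𝓘(ℝ, E)).target := by
      simp [h.domChart.map_source hy]
    have := h.writtenInCharts hm
    simpa [hL, hy] using this
  have h1 := heq.mfderiv_eq (I := 𝓘(ℝ, E)) (I' := 𝓘(ℝ, E'))
  rw [mfderiv_comp x (hψ.mdifferentiableAt hy) hf,
    mfderiv_comp x L.differentiableAt.mdifferentiableAt (hφ.mdifferentiableAt hx),
    mfderiv_eq_fderiv, L.fderiv] at h1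
  intro w
  obtain ⟨u, hu⟩ := hLs (mfderiv 𝓘(ℝ, E') 𝓘(ℝ, E') h.codChart (f x) w)
  obtain ⟨a, ha⟩ := (hφ.mfderiv_bijective hx).2 u
  refine ⟨a, (hψ.mfderiv_bijective hy).1 ?_⟩
  have h2 := DFunLike.congr_fun h1 a
  refine h2.trans ?_
  refine Eq.trans ?_ hu
  exact congrArg L ha

instance finiteDimensional_tangentSpace {E : Type*} [NormedAddCommGroup E] [NormedSpace ℝ E]
    [FiniteDimensional ℝ E] {M : Type*} [TopologicalSpace M] [ChartedSpace E M] (x : M) :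
    FiniteDimensional ℝ (TangentSpace 𝓘(ℝ, E) x) :=
  inferInstanceAs (FiniteDimensional ℝ E)

instance t2Space_tangentSpace {E : Type*} [NormedAddCommGroup E] [NormedSpace ℝ E]
    {M : Type*} [TopologicalSpace M] [ChartedSpace E M] (x : M) :
    T2Space (TangentSpace 𝓘(ℝ, E) x) :=
  inferInstanceAs (T2Space E)

/-- If `Z` takes values in moving subspaces with a continuous frame and `Z p = 0`, then the derivative
of `Z` at `p` takes values in the subspace at `p`. -/
theorem fderiv_mem_span_of_eventually_mem {E : Type*} [NormedAddCommGroup E] [NormedSpace ℝ E]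
    {r : ℕ} {Z : E → E} {e : Fin r → E → E} {p : E} (hZ : DifferentiableAt ℝ Z p) (hp : Z p = 0)
    (he : ∀ j, ContinuousAt (e j) p) (hli : LinearIndependent ℝ fun j => e j p)
    (hmem : ∀ᶠ y in 𝓝 p, Z y ∈ Submodule.span ℝ (Set.range fun j => e j y)) (u : E) :
    fderiv ℝ Z p u ∈ Submodule.span ℝ (Set.range fun j => e j p) := by
  by_contra hw
  have hli' : LinearIndependent ℝ (Fin.cons (fderiv ℝ Z p u) (fun j => e j p) : Fin (r + 1) → E) :=
    linearIndependent_finCons.2 ⟨hli, hw⟩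
  have hline : Filter.Tendsto (fun t : ℝ => p + t • u) (𝓝[≠] 0) (𝓝 p) := by
    have : ContinuousAt (fun t : ℝ => p + t • u) 0 := by fun_prop
    have h := this.tendsto
    simp only [zero_smul, add_zero] at h
    exact h.mono_left nhdsWithin_le_nhds
  have hder : Filter.Tendsto (fun t : ℝ => t⁻¹ • Z (p + t • u)) (𝓝[≠] 0)
      (𝓝 (fderiv ℝ Z p u)) := by
    have := (hZ.hasFDerivAt.hasLineDerivAt u).tendsto_slope_zero
    simpa [hp] using this
  have hT : Filter.Tendsto (fun t : ℝ => (Fin.cons (t⁻¹ • Z (p + t • u))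
      (fun j => e j (p + t • u)) : Fin (r + 1) → E)) (𝓝[≠] 0)
      (𝓝 (Fin.cons (fderiv ℝ Z p u) (fun j => e j p))) := by
    rw [tendsto_pi_nhds]
    intro j
    refine Fin.cases ?_ (fun j => ?_) j
    · simpa using hder
    · simpa [Function.comp_def] using (he j).tendsto.comp hline
  have h1 := hT.eventually (isOpen_setOfPred_linearIndependent.mem_nhds hli')
  obtain ⟨t, ht1, ht2⟩ := (h1.and (hline.eventually hmem)).exists
  exact (linearIndependent_finCons.1 ht1).2 (Submodule.smul_mem _ _ ht2)

theorem map_mem_span_range {E F : Type*} [AddCommGroup E] [Module ℝ E] [AddCommGroup F]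
    [Module ℝ F] (L : E →ₗ[ℝ] F) {ι : Type*} {e : ι → E} {z : E}
    (h : z ∈ Submodule.span ℝ (Set.range e)) :
    L z ∈ Submodule.span ℝ (Set.range fun j => L (e j)) := by
  have : (Set.range fun j => L (e j)) = L '' Set.range e := by
    rw [← Set.range_comp]; rfl
  rw [this, ← Submodule.map_span]
  exact Submodule.mem_map_of_mem h

theorem lieBracketWithin_univ_of_eq_zero {E : Type*} [NormedAddCommGroup E] [NormedSpace ℝ E]
    {Z W : E → E} {p : E} (hp : Z p = 0) :
    VectorField.lieBracketWithin ℝ Z W Set.univ p = -(fderiv ℝ Z p (W p)) := by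
  rw [VectorField.lieBracketWithin_univ, VectorField.lieBracket, hp, map_zero, zero_sub]

section Geometry

variable {E : Type*} [NormedAddCommGroup E] [NormedSpace ℝ E]
  {E' : Type*} [NormedAddCommGroup E'] [NormedSpace ℝ E']
  {M : Type*} [TopologicalSpace M] [ChartedSpace E M] [IsManifold 𝓘(ℝ, E) ∞ M]
  {N : Type*} [TopologicalSpace N] [ChartedSpace E' N] [IsManifold 𝓘(ℝ, E') ∞ N]

/-- `K` is a smooth subbundle, over the subset `S` of `M`, of the pullback bundle `f^*(TN)`:
near every point of `S` the subspaces `K x ⊆ T_{f x} N`, `x ∈ S`, have a smooth frame.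
For `f = id` these are the subbundles of `TM` over `S`. -/
def IsSmoothSubbundleOn (f : M → N) (S : Set M)
    (K : ∀ x : M, Submodule ℝ (TangentSpace 𝓘(ℝ, E') (f x))) : Prop :=
  ∀ x ∈ S, ∃ U : Set M, IsOpen U ∧ x ∈ U ∧
    ∃ (r : ℕ) (e : Fin r → ∀ y : M, TangentSpace 𝓘(ℝ, E') (f y)),
      (∀ j, ContMDiffOn 𝓘(ℝ, E) 𝓘(ℝ, E').tangent ∞
        (fun y => (⟨f y, e j y⟩ : TangentBundle 𝓘(ℝ, E') N)) (S ∩ U)) ∧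
      ∀ y ∈ S ∩ U, LinearIndependent ℝ (fun j => e j y) ∧
        Submodule.span ℝ (Set.range fun j => e j y) = K y

/-- `X` is a smooth vector field near `x` with values in the distribution `K`. -/
def IsLocalSection (K : ∀ x : M, Submodule ℝ (TangentSpace 𝓘(ℝ, E) x)) (x : M)
    (X : ∀ y : M, TangentSpace 𝓘(ℝ, E) y) : Prop :=
  ∃ U : Set M, IsOpen U ∧ x ∈ U ∧
    ContMDiffOn 𝓘(ℝ, E) 𝓘(ℝ, E).tangent ∞
      (fun y => (⟨y, X y⟩ : TangentBundle 𝓘(ℝ, E) M)) U ∧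
    ∀ y ∈ U, X y ∈ K y

open Classical in
/-- The curvature two-form `Δ_K` of a distribution `K ⊆ TM`, with values in `TM / K`:
`Δ_K(a, b) = -ν [X, Y](x)`, where `ν : TM → TM / K` is the quotient map and `X`, `Y` are local
vector fields with values in `K` that extend `a, b ∈ K x`. By `curvature_eq`, for a subbundle `K`
the value does not depend on the choice of `X`, `Y`. -/
def curvature (K : ∀ x : M, Submodule ℝ (TangentSpace 𝓘(ℝ, E) x)) (x : M)
    (a b : TangentSpace 𝓘(ℝ, E) x) : TangentSpace 𝓘(ℝ, E) x ⧸ K x :=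
  if h : ∃ XY : (∀ y : M, TangentSpace 𝓘(ℝ, E) y) × (∀ y : M, TangentSpace 𝓘(ℝ, E) y),
      IsLocalSection K x XY.1 ∧ IsLocalSection K x XY.2 ∧ XY.1 x = a ∧ XY.2 x = b then
    -(K x).mkQ (VectorField.mlieBracket 𝓘(ℝ, E) h.choose.1 h.choose.2 x)
  else 0

theorem IsLocalSection.contMDiffAt {K : ∀ x : M, Submodule ℝ (TangentSpace 𝓘(ℝ, E) x)} {x : M}
    {X : ∀ y : M, TangentSpace 𝓘(ℝ, E) y} (h : IsLocalSection K x X) :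
    ContMDiffAt 𝓘(ℝ, E) 𝓘(ℝ, E).tangent ∞
      (fun y => (⟨y, X y⟩ : TangentBundle 𝓘(ℝ, E) M)) x := by
  obtain ⟨U, hU, hx, hX, -⟩ := h
  exact hX.contMDiffAt (hU.mem_nhds hx)

theorem IsLocalSection.sub {K : ∀ x : M, Submodule ℝ (TangentSpace 𝓘(ℝ, E) x)} {x : M}
    {X Y : ∀ y : M, TangentSpace 𝓘(ℝ, E) y} (h : IsLocalSection K x X)
    (h' : IsLocalSection K x Y) : IsLocalSection K x (X - Y) := by
  obtain ⟨U, hU, hx, hX, hK⟩ := h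
  obtain ⟨U', hU', hx', hX', hK'⟩ := h'
  refine ⟨U ∩ U', hU.inter hU', ⟨hx, hx'⟩, ?_, fun y hy => (K y).sub_mem (hK y hy.1) (hK' y hy.2)⟩
  exact (hX.mono Set.inter_subset_left).sub_section (hX'.mono Set.inter_subset_right)

/-- The bracket of two vector fields of a subbundle lies in it where one of them vanishes. -/
theorem mlieBracket_mem_of_eq_zero [FiniteDimensional ℝ E]
    {K : ∀ x : M, Submodule ℝ (TangentSpace 𝓘(ℝ, E) x)}
    (hK : IsSmoothSubbundleOn (E := E) (fun x : M => x) Set.univ K) {x : M}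
    {Z Y : ∀ y : M, TangentSpace 𝓘(ℝ, E) y} (hZ : IsLocalSection K x Z) (hZx : Z x = 0) :
    VectorField.mlieBracket 𝓘(ℝ, E) Z Y x ∈ K x := by
  obtain ⟨U, hU, hxU, r, e, he, hspan⟩ := hK x (Set.mem_univ x)
  have hcd : ∀ X : (∀ y : M, TangentSpace 𝓘(ℝ, E) y),
      ContMDiffAt 𝓘(ℝ, E) 𝓘(ℝ, E).tangent ∞
        (fun y => (⟨y, X y⟩ : TangentBundle 𝓘(ℝ, E) M)) x →
      ContDiffAt ℝ 1 (VectorField.mpullbackWithin 𝓘(ℝ, E) 𝓘(ℝ, E)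
        (extChartAt 𝓘(ℝ, E) x).symm X (Set.range 𝓘(ℝ, E))) (extChartAt 𝓘(ℝ, E) x x) := by
    intro X hX
    have h1 := VectorField.contMDiffWithinAt_mpullbackWithin_extChartAt_symm (m := 1) (n := ∞)
      ((hX.of_le (by simp)).contMDiffWithinAt (s := Set.univ)) uniqueMDiffOn_univ
      (Set.mem_univ x) (by rw [one_add_one_eq_two]; exact ENat.LEInfty.out)
    rw [Set.preimage_univ, Set.inter_univ] at h1
    exact (contMDiffWithinAt_vectorSpace_iff_contDiffWithinAt.1 h1).contDiffAt
      (extChartAt_target_mem_nhds x)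
  have hback : ∀ X : (∀ y : M, TangentSpace 𝓘(ℝ, E) y),
      X x = (mfderiv 𝓘(ℝ, E) 𝓘(ℝ, E) (extChartAt 𝓘(ℝ, E) x) x).inverse
        (VectorField.mpullbackWithin 𝓘(ℝ, E) 𝓘(ℝ, E)
        (extChartAt 𝓘(ℝ, E) x).symm X (Set.range 𝓘(ℝ, E)) (extChartAt 𝓘(ℝ, E) x x)) := by
    intro X
    exact (VectorField.eventuallyEq_mpullback_mpullbackWithin_extChartAt (s := Set.univ)
      X).self_of_nhdsWithin (Set.mem_univ x)
  have hp : (extChartAt 𝓘(ℝ, E) x).symm (extChartAt 𝓘(ℝ, E) x x) = x := extChartAt_to_inv x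
  have hcont : Filter.Tendsto (extChartAt 𝓘(ℝ, E) x).symm (𝓝 (extChartAt 𝓘(ℝ, E) x x)) (𝓝 x) := by
    have := (continuousAt_extChartAt_symm (I := 𝓘(ℝ, E)) x).tendsto
    rwa [hp] at this
  have hZ1 := hcd Z hZ.contMDiffAt
  have hZ0 : VectorField.mpullbackWithin 𝓘(ℝ, E) 𝓘(ℝ, E)
      (extChartAt 𝓘(ℝ, E) x).symm Z (Set.range 𝓘(ℝ, E)) (extChartAt 𝓘(ℝ, E) x x) = 0 := by
    rw [VectorField.mpullbackWithin_apply, hp, hZx, map_zero]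
  obtain ⟨U', hU', hxU', -, hZK⟩ := hZ
  have key := fderiv_mem_span_of_eventually_mem
    (e := fun j => VectorField.mpullbackWithin 𝓘(ℝ, E) 𝓘(ℝ, E)
      (extChartAt 𝓘(ℝ, E) x).symm (e j) (Set.range 𝓘(ℝ, E)))
    (hZ1.differentiableAt one_ne_zero) hZ0
    (fun j => (hcd (e j) ((he j).contMDiffAt (by simpa using hU.mem_nhds hxU))).continuousAt)
    (by
      obtain ⟨B, hB⟩ := isInvertible_mfderivWithin_extChartAt_symm (I := 𝓘(ℝ, E))
        (mem_extChartAt_target (I := 𝓘(ℝ, E)) x)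
      have hinj : Function.Injective (mfderivWithin 𝓘(ℝ, E) 𝓘(ℝ, E) (extChartAt 𝓘(ℝ, E) x).symm
          (Set.range 𝓘(ℝ, E)) (extChartAt 𝓘(ℝ, E) x x)).inverse := by
        rw [← hB, ContinuousLinearMap.inverse_equiv]
        exact B.symm.injective
      have hli : LinearIndependent ℝ fun j => e j ((extChartAt 𝓘(ℝ, E) x).symm
          (extChartAt 𝓘(ℝ, E) x x)) := by
        rw [hp]; exact (hspan x ⟨Set.mem_univ x, hxU⟩).1
      exact hli.map' (mfderivWithin 𝓘(ℝ, E) 𝓘(ℝ, E) (extChartAt 𝓘(ℝ, E) x).symm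
          (Set.range 𝓘(ℝ, E)) (extChartAt 𝓘(ℝ, E) x x)).inverse.toLinearMap
        (LinearMap.ker_eq_bot.2 hinj))
    (by
      filter_upwards [hcont.eventually (hU.mem_nhds hxU), hcont.eventually (hU'.mem_nhds hxU')]
        with y hy hy'
      have hm : Z ((extChartAt 𝓘(ℝ, E) x).symm y) ∈ Submodule.span ℝ
          (Set.range fun j => e j ((extChartAt 𝓘(ℝ, E) x).symm y)) := by
        rw [(hspan _ ⟨Set.mem_univ _, hy⟩).2]
        exact hZK _ hy'
      exact map_mem_span_range (mfderivWithin 𝓘(ℝ, E) 𝓘(ℝ, E) (extChartAt 𝓘(ℝ, E) x).symm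
        (Set.range 𝓘(ℝ, E)) y).inverse.toLinearMap hm)
    (VectorField.mpullbackWithin 𝓘(ℝ, E) 𝓘(ℝ, E)
        (extChartAt 𝓘(ℝ, E) x).symm Y (Set.range 𝓘(ℝ, E)) (extChartAt 𝓘(ℝ, E) x x))
  have hset : (extChartAt 𝓘(ℝ, E) x).symm ⁻¹' Set.univ ∩ Set.range 𝓘(ℝ, E) = Set.univ := by simp
  have hb := lieBracketWithin_univ_of_eq_zero (W := VectorField.mpullbackWithin 𝓘(ℝ, E) 𝓘(ℝ, E)
    (extChartAt 𝓘(ℝ, E) x).symm Y (Set.range 𝓘(ℝ, E))) hZ0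
  rw [← VectorField.mlieBracketWithin_univ, VectorField.mlieBracketWithin_apply, hset]
  have hfin := map_mem_span_range
    (mfderiv 𝓘(ℝ, E) 𝓘(ℝ, E) (extChartAt 𝓘(ℝ, E) x) x).inverse.toLinearMap
    (hb ▸ Submodule.neg_mem _ key)
  have hfun : (fun j => e j x) = fun j =>
      (mfderiv 𝓘(ℝ, E) 𝓘(ℝ, E) (extChartAt 𝓘(ℝ, E) x) x).inverse
        (VectorField.mpullbackWithin 𝓘(ℝ, E) 𝓘(ℝ, E)
        (extChartAt 𝓘(ℝ, E) x).symm (e j) (Set.range 𝓘(ℝ, E)) (extChartAt 𝓘(ℝ, E) x x)) :=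
    funext fun j => hback (e j)
  rw [← (hspan x ⟨Set.mem_univ x, hxU⟩).2, hfun]
  exact hfin

/-- The curvature `Δ_K(X(x), Y(x)) = -ν [X, Y](x)` is well defined. -/
theorem curvature_eq [FiniteDimensional ℝ E]
    {K : ∀ x : M, Submodule ℝ (TangentSpace 𝓘(ℝ, E) x)}
    (hK : IsSmoothSubbundleOn (E := E) (fun x : M => x) Set.univ K) {x : M}
    {X Y : ∀ y : M, TangentSpace 𝓘(ℝ, E) y} (hX : IsLocalSection K x X)
    (hY : IsLocalSection K x Y) :
    curvature K x (X x) (Y x) = -(K x).mkQ (VectorField.mlieBracket 𝓘(ℝ, E) X Y x) := by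
  have h : ∃ XY : (∀ y : M, TangentSpace 𝓘(ℝ, E) y) × (∀ y : M, TangentSpace 𝓘(ℝ, E) y),
      IsLocalSection K x XY.1 ∧ IsLocalSection K x XY.2 ∧ XY.1 x = X x ∧ XY.2 x = Y x :=
    ⟨(X, Y), hX, hY, rfl, rfl⟩
  rw [curvature, dif_pos h, neg_inj, ← sub_eq_zero, ← map_sub, Submodule.mkQ_apply,
    Submodule.Quotient.mk_eq_zero]
  obtain ⟨h1, h2, h3, h4⟩ := h.choose_spec
  set X' := h.choose.1
  set Y' := h.choose.2
  have hd : ∀ {W}, IsLocalSection K x W → MDifferentiableAt 𝓘(ℝ, E) 𝓘(ℝ, E).tangent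
      (fun y => (⟨y, W y⟩ : TangentBundle 𝓘(ℝ, E) M)) x :=
    fun hW => hW.contMDiffAt.mdifferentiableAt (by simp)
  have e1 : VectorField.mlieBracket 𝓘(ℝ, E) X' Y' x =
      VectorField.mlieBracket 𝓘(ℝ, E) (X' - X) Y' x + VectorField.mlieBracket 𝓘(ℝ, E) X Y' x := by
    rw [← VectorField.mlieBracket_add_left (hd (h1.sub hX)) (hd hX), sub_add_cancel]
  have e2 : VectorField.mlieBracket 𝓘(ℝ, E) Y' X x =
      VectorField.mlieBracket 𝓘(ℝ, E) (Y' - Y) X x + VectorField.mlieBracket 𝓘(ℝ, E) Y X x := by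
    rw [← VectorField.mlieBracket_add_left (hd (h2.sub hY)) (hd hY), sub_add_cancel]
  have m1 := mlieBracket_mem_of_eq_zero (Y := Y') hK (h1.sub hX) (by simp [h3])
  have m2 := mlieBracket_mem_of_eq_zero (Y := X) hK (h2.sub hY) (by simp [h4])
  rw [VectorField.mlieBracket_swap_apply (V := X) (W := Y')] at e1
  rw [VectorField.mlieBracket_swap_apply (V := X) (W := Y), e1, e2]
  convert (K x).sub_mem m1 m2 using 1
  abel

/-- A one-form is smooth if it is a smooth section of the cotangent bundle. -/
def IsSmoothOneForm (θ : ∀ x : M, TangentSpace 𝓘(ℝ, E) x →L[ℝ] ℝ) : Prop :=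
  ContMDiff 𝓘(ℝ, E) (𝓘(ℝ, E).prod 𝓘(ℝ, E →L[ℝ] ℝ)) ∞
    (fun x => Bundle.TotalSpace.mk' (E →L[ℝ] ℝ)
      (E := fun x : M => TangentSpace 𝓘(ℝ, E) x →L[ℝ] Bundle.Trivial M ℝ x) x (θ x))

/-- The coordinate expression of the one-form `θ` in the preferred chart at `x`, i.e. the pullback
of `θ` by the inverse of that chart. -/
def oneFormInChart (θ : ∀ x : M, TangentSpace 𝓘(ℝ, E) x →L[ℝ] ℝ) (x : M) (y : E) : E →L[ℝ] ℝ :=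
  (θ ((extChartAt 𝓘(ℝ, E) x).symm y)).comp
    (mfderiv 𝓘(ℝ, E) 𝓘(ℝ, E) (extChartAt 𝓘(ℝ, E) x).symm y)

/-- The exterior derivative `dθ(x)(a, b)` of a one-form, computed in the preferred chart at `x`,
with the convention `dθ(X, Y) = X(θ(Y)) - Y(θ(X)) - θ([X, Y])`. -/
def extDerivOneForm (θ : ∀ x : M, TangentSpace 𝓘(ℝ, E) x →L[ℝ] ℝ) (x : M)
    (a b : TangentSpace 𝓘(ℝ, E) x) : ℝ :=
  let φ := extChartAt 𝓘(ℝ, E) x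
  let a' : E := mfderiv 𝓘(ℝ, E) 𝓘(ℝ, E) φ x a
  let b' : E := mfderiv 𝓘(ℝ, E) 𝓘(ℝ, E) φ x b
  fderiv ℝ (oneFormInChart θ x) (φ x) a' b' - fderiv ℝ (oneFormInChart θ x) (φ x) b' a'

end Geometry

/-! ### Discrete tangent bundles and discrete constrained Lagrangian systems -/

section Discrete

variable (EQ : Type*) [NormedAddCommGroup EQ] [NormedSpace ℝ EQ] [FiniteDimensional ℝ EQ]
  (Q : Type*) [TopologicalSpace Q] [ChartedSpace EQ Q] [IsManifold 𝓘(ℝ, EQ) ∞ Q]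
  (EV : Type*) [NormedAddCommGroup EV] [NormedSpace ℝ EV] [FiniteDimensional ℝ EV]
  (V : Type*) [TopologicalSpace V] [ChartedSpace EV V] [IsManifold 𝓘(ℝ, EV) ∞ V]
  (ED : Type*) [NormedAddCommGroup ED] [NormedSpace ℝ ED] [FiniteDimensional ℝ ED]
  (D : Type*) [TopologicalSpace D] [ChartedSpace ED D] [IsManifold 𝓘(ℝ, ED) ∞ D]

/-- A discrete tangent bundle `(V, ∂⁺, ∂⁻)` of the manifold `Q`: `dim V = 2 dim Q`, the maps
`∂⁺, ∂⁻ : V → Q` are submersions with `ker T∂⁺ ∩ ker T∂⁻ = 0`, and for every `q` the fibers of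
`∂⁺` and `∂⁻` over `q` meet in exactly one point. -/
structure DiscreteTangentBundle where
  plus : V → Q
  minus : V → Q
  finrank_eq : Module.finrank ℝ EV = 2 * Module.finrank ℝ EQ
  plus_submersion : Manifold.IsSubmersion 𝓘(ℝ, EV) 𝓘(ℝ, EQ) ∞ plus
  minus_submersion : Manifold.IsSubmersion 𝓘(ℝ, EV) 𝓘(ℝ, EQ) ∞ minus
  ker_inf_ker : ∀ (v : V) (a : TangentSpace 𝓘(ℝ, EV) v),
    mfderiv 𝓘(ℝ, EV) 𝓘(ℝ, EQ) plus v a = 0 → mfderiv 𝓘(ℝ, EV) 𝓘(ℝ, EQ) minus v a = 0 → a = 0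
  existsUnique_zero : ∀ q : Q, ∃! v : V, plus v = q ∧ minus v = q

namespace DiscreteTangentBundle

variable {EQ Q EV V}
variable (T : DiscreteTangentBundle EQ Q EV V)

/-- The tangent map `T_v ∂⁺`. -/
abbrev dPlus (v : V) :
    TangentSpace 𝓘(ℝ, EV) v →L[ℝ] TangentSpace 𝓘(ℝ, EQ) (T.plus v) :=
  mfderiv 𝓘(ℝ, EV) 𝓘(ℝ, EQ) T.plus v

/-- The tangent map `T_v ∂⁻`. -/
abbrev dMinus (v : V) :
    TangentSpace 𝓘(ℝ, EV) v →L[ℝ] TangentSpace 𝓘(ℝ, EQ) (T.minus v) :=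
  mfderiv 𝓘(ℝ, EV) 𝓘(ℝ, EQ) T.minus v

/-- The backward vertical space `vert⁺_v V = ker T_v ∂⁺`. -/
def vertPlus (v : V) : Submodule ℝ (TangentSpace 𝓘(ℝ, EV) v) :=
  LinearMap.ker (T.dPlus v).toLinearMap

/-- The forward vertical space `vert⁻_v V = ker T_v ∂⁻`. -/
def vertMinus (v : V) : Submodule ℝ (TangentSpace 𝓘(ℝ, EV) v) :=
  LinearMap.ker (T.dMinus v).toLinearMap

set_option linter.unusedSectionVars false in
/-- `T_v V = vert⁻_v V ⊕ vert⁺_v V`. -/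
theorem isCompl_vert (v : V) : IsCompl (T.vertMinus v) (T.vertPlus v) := by
  have hE : Module.finrank ℝ (TangentSpace 𝓘(ℝ, EV) v) = Module.finrank ℝ EV := rfl
  have hE' : ∀ q : Q, Module.finrank ℝ (TangentSpace 𝓘(ℝ, EQ) q) = Module.finrank ℝ EQ :=
    fun _ => rfl
  have h1 := (T.dPlus v).toLinearMap.finrank_range_add_finrank_ker
  have h2 := (T.dMinus v).toLinearMap.finrank_range_add_finrank_ker
  rw [LinearMap.range_eq_top.2 (surjective_mfderiv_of_isSubmersionAt
    (T.plus_submersion.isSubmersionAt v)), finrank_top, hE, hE'] at h1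
  rw [LinearMap.range_eq_top.2 (surjective_mfderiv_of_isSubmersionAt
    (T.minus_submersion.isSubmersionAt v)), finrank_top, hE, hE'] at h2
  have h3 := T.finrank_eq
  have hd : Disjoint (T.vertMinus v) (T.vertPlus v) := by
    rw [Submodule.disjoint_def]
    intro a ha hb
    exact T.ker_inf_ker v a hb ha
  have h1' : Module.finrank ℝ EQ + Module.finrank ℝ (T.vertPlus v) = Module.finrank ℝ EV := h1
  have h2' : Module.finrank ℝ EQ + Module.finrank ℝ (T.vertMinus v) = Module.finrank ℝ EV := h2
  refine Submodule.isCompl_iff_disjoint _ _ ?_ |>.2 hd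
  rw [hE]
  omega

/-- `δv ↦ δv⁺`, the component in `vert⁻_v V = ker T_v ∂⁻` of a tangent vector, in the decomposition
`T_v V = vert⁻_v V ⊕ vert⁺_v V`. -/
def plusPart (v : V) : TangentSpace 𝓘(ℝ, EV) v →L[ℝ] TangentSpace 𝓘(ℝ, EV) v :=
  LinearMap.toContinuousLinearMap
    ((T.vertMinus v).projection (T.vertPlus v) (T.isCompl_vert v))

/-- `δv ↦ δv⁻`, the component in `vert⁺_v V = ker T_v ∂⁺` of a tangent vector, in the decomposition
`T_v V = vert⁻_v V ⊕ vert⁺_v V`. -/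
def minusPart (v : V) : TangentSpace 𝓘(ℝ, EV) v →L[ℝ] TangentSpace 𝓘(ℝ, EV) v :=
  LinearMap.toContinuousLinearMap
    ((T.vertPlus v).projection (T.vertMinus v) (T.isCompl_vert v).symm)

end DiscreteTangentBundle

/-- A discrete constrained Lagrangian system `(V, σ, 𝒟, ℰ)`. The velocity constraint, a submanifold
of `V`, is the image of the smooth embedding `incl : D → V` of a manifold `D`; `ℰ` is a subbundle
of the pullback `(∂⁺|𝒟)^*(TQ)`. -/
structure DCLS extends DiscreteTangentBundle EQ Q EV V where
  σ : ∀ v : V, TangentSpace 𝓘(ℝ, EV) v →L[ℝ] ℝ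
  smooth_σ : IsSmoothOneForm σ
  incl : D → V
  incl_embedding : Manifold.IsSmoothEmbedding 𝓘(ℝ, ED) 𝓘(ℝ, EV) ∞ incl
  plus_incl_submersion : Manifold.IsSubmersion 𝓘(ℝ, ED) 𝓘(ℝ, EQ) ∞ (fun x => plus (incl x))
  minus_incl_submersion : Manifold.IsSubmersion 𝓘(ℝ, ED) 𝓘(ℝ, EQ) ∞ (fun x => minus (incl x))
  ℰ : ∀ x : D, Submodule ℝ (TangentSpace 𝓘(ℝ, EQ) (plus (incl x)))
  smooth_ℰ : IsSmoothSubbundleOn (E := ED) (fun x => plus (incl x)) Set.univ ℰ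

namespace DCLS

variable {EQ Q EV V ED D}
variable (S : DCLS EQ Q EV V ED D)

/-- The inclusion `T_x 𝒟 → T_x V`. -/
abbrev dIncl (x : D) :
    TangentSpace 𝓘(ℝ, ED) x →L[ℝ] TangentSpace 𝓘(ℝ, EV) (S.incl x) :=
  mfderiv 𝓘(ℝ, ED) 𝓘(ℝ, EV) S.incl x

/-- The pair `(x, y)` of points of `𝒟` is a solution pair: it satisfies the discrete
Lagrange-d'Alembert principle for sequences of length two. That is, `∂⁺(x) = ∂⁻(y)`, and
`Σ(δv, δw) = σ(x) δv + σ(y) δw` vanishes for all variations with `T∂⁺(δv) = T∂⁻(δw)`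
(first order), `T∂⁻(δv) = 0`, `T∂⁺(δw) = 0` (fixed boundary) and `T∂⁺(δv) ∈ ℰ`. -/
structure IsSolutionPair (x y : D) : Prop where
  first_order : S.plus (S.incl x) = S.minus (S.incl y)
  critical : ∀ (δv : TangentSpace 𝓘(ℝ, EV) (S.incl x)) (δw : TangentSpace 𝓘(ℝ, EV) (S.incl y)),
    tangentMap 𝓘(ℝ, EV) 𝓘(ℝ, EQ) S.plus ⟨S.incl x, δv⟩ =
      tangentMap 𝓘(ℝ, EV) 𝓘(ℝ, EQ) S.minus ⟨S.incl y, δw⟩ →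
    S.dMinus (S.incl x) δv = 0 → S.dPlus (S.incl y) δw = 0 →
    S.dPlus (S.incl x) δv ∈ S.ℰ x →
    S.σ (S.incl x) δv + S.σ (S.incl y) δw = 0

/-- `F : U → 𝒟`, with `U` open in `𝒟`, is a (smooth) evolution map of the system. -/
structure IsEvolutionMap (U : Set D) (F : D → D) : Prop where
  isOpen : IsOpen U
  smooth : ContMDiffOn 𝓘(ℝ, ED) 𝓘(ℝ, ED) ∞ F U
  isSolutionPair : ∀ x ∈ U, S.IsSolutionPair x (F x)

/-- The one-form `θ⁺(v) δv = σ(v) δv⁺`. -/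
def θPlus (v : V) : TangentSpace 𝓘(ℝ, EV) v →L[ℝ] ℝ :=
  (S.σ v).comp (S.plusPart v)

/-- The one-form `θ⁻(v) δv = -σ(v) δv⁻`. -/
def θMinus (v : V) : TangentSpace 𝓘(ℝ, EV) v →L[ℝ] ℝ :=
  -(S.σ v).comp (S.minusPart v)

/-- The two-form `ω⁺ = -dθ⁺`. -/
def ωPlus (v : V) (a b : TangentSpace 𝓘(ℝ, EV) v) : ℝ :=
  -extDerivOneForm S.θPlus v a b

/-- The two-form `ω⁻ = -dθ⁻`. -/
def ωMinus (v : V) (a b : TangentSpace 𝓘(ℝ, EV) v) : ℝ :=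
  -extDerivOneForm S.θMinus v a b

/-- The distribution `𝒦⁺ = {δv ∈ T𝒟 : T∂⁺(δv) ∈ ℰ}` on `𝒟`. -/
def KPlus (x : D) : Submodule ℝ (TangentSpace 𝓘(ℝ, ED) x) :=
  (S.ℰ x).comap ((S.dPlus (S.incl x)).comp (S.dIncl x)).toLinearMap

end DCLS

end Discrete

end

end DiscreteLagrange

/-! Two identities between one-forms carry the theorem. First, `δv = δv⁺ + δv⁻` gives `θ⁺ - θ⁻ = σ`
(`θMinus_eq`), hence `ω⁺ - ω⁻ = -dσ`, which vanishes on `K₀` by the closedness hypothesis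
(`ωPlus_eq_ωMinus`).

Second, let `α = i^*θ⁺ - (i ∘ F)^*θ⁻` be the `defect`, with `i` the inclusion of `𝒟`. For `a ∈ 𝒦⁺`
the vectors `(Ti a)⁺` and `(T(i ∘ F) a)⁻` are admissible variations of the solution pair `(x, F x)`,
and criticality says exactly `α(a) = 0` (`IsEvolutionMap.defect_apply_eq_zero`). A form annihilating
`𝒦⁺` satisfies `dα(X, Y) = -α([X, Y])` on sections of `𝒦⁺`; where the curvature vanishes, `[X, Y]`
lies in `𝒦⁺` and so `dα(X, Y) = 0` (`IsEvolutionMap.extDerivOneForm_defect_eq_zero`). As `d`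
commutes with pullback, `F` pulls `ω⁻` back to `ω⁺` on `K₀` (`IsEvolutionMap.ωMinus_mfderiv`).
Invariance of `K₀` allows `ω⁺ = ω⁻` to be used at `F x` as well as at `x`, which gives both signs.

The remaining work is analytic: calculus in the preferred charts, differentiability of `θ⁺` and
`θ⁻`, and extension of vectors of `𝒦⁺` to local sections. -/

namespace DiscreteLagrange

/-! ### Calculus of one-forms and families of linear maps in vector spaces -/

section Calculus

variable {E : Type*} [NormedAddCommGroup E] [NormedSpace ℝ E]
  {E' : Type*} [NormedAddCommGroup E'] [NormedSpace ℝ E']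

/-- Exterior differentiation of one-forms commutes with pullbacks. -/
theorem fderiv_comp_fderiv_sub_swap {β : E' → E' →L[ℝ] ℝ} {g : E → E'} {p : E}
    (hg : ContDiffAt ℝ 2 g p) (hβ : DifferentiableAt ℝ β (g p)) (a b : E) :
    fderiv ℝ (fun y => (β (g y)).comp (fderiv ℝ g y)) p a b
        - fderiv ℝ (fun y => (β (g y)).comp (fderiv ℝ g y)) p b a =
      fderiv ℝ β (g p) (fderiv ℝ g p a) (fderiv ℝ g p b)
        - fderiv ℝ β (g p) (fderiv ℝ g p b) (fderiv ℝ g p a) := by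
  have hg1 : DifferentiableAt ℝ g p := hg.differentiableAt (by simp)
  have hg2 : DifferentiableAt ℝ (fderiv ℝ g) p :=
    (hg.fderiv_right (m := 1) (by norm_num)).differentiableAt (by simp)
  have hβg : HasFDerivAt (fun y => β (g y)) ((fderiv ℝ β (g p)).comp (fderiv ℝ g p)) p :=
    hβ.hasFDerivAt.comp p hg1.hasFDerivAt
  -- The terms `β (D²g a b)` and `β (D²g b a)` cancel by symmetry of the second derivative.
  have hsymm : IsSymmSndFDerivAt ℝ g p := hg.isSymmSndFDerivAt (by simp)
  rw [(hβg.clm_comp hg2.hasFDerivAt).fderiv]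
  simp [hsymm.eq a b]

/-- A one-form annihilating two vector fields and, at `p`, their bracket has exterior derivative
zero on their values at `p`. -/
theorem fderiv_sub_swap_eq_zero_of_annihilates {β : E → E →L[ℝ] ℝ} {X Y : E → E} {p : E}
    (hβ : DifferentiableAt ℝ β p) (hX : DifferentiableAt ℝ X p) (hY : DifferentiableAt ℝ Y p)
    (hβX : ∀ᶠ y in 𝓝 p, β y (X y) = 0) (hβY : ∀ᶠ y in 𝓝 p, β y (Y y) = 0)
    (hbr : β p (VectorField.lieBracket ℝ X Y p) = 0) :
    fderiv ℝ β p (X p) (Y p) - fderiv ℝ β p (Y p) (X p) = 0 := by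
  -- Product rule for `β(Z) = 0`. Applied to `Y` along `X p` and to `X` along `Y p`, it turns the
  -- exterior derivative into `-β([X, Y])`.
  have key : ∀ {Z : E → E}, DifferentiableAt ℝ Z p → (∀ᶠ y in 𝓝 p, β y (Z y) = 0) →
      ∀ u, β p (fderiv ℝ Z p u) + fderiv ℝ β p u (Z p) = 0 := by
    intro Z hZ h u
    have h0 : (fun y => β y (Z y)) =ᶠ[𝓝 p] fun _ => 0 := h
    have h1 := h0.fderiv_eq (𝕜 := ℝ)
    rw [(hβ.hasFDerivAt.clm_apply hZ.hasFDerivAt).fderiv, fderiv_const_apply] at h1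
    simpa using DFunLike.congr_fun h1 u
  have h1 := key hY hβY (X p)
  have h2 := key hX hβX (Y p)
  rw [VectorField.lieBracket, map_sub] at hbr
  linarith

/-- A smooth family of vectors in the target of a smooth family of linear maps, surjective at `p`,
lifts to a smooth family with any prescribed value at `p`. -/
theorem exists_contDiffAt_lift [FiniteDimensional ℝ E] [FiniteDimensional ℝ E']
    {L : E → E →L[ℝ] E'} {s : E → E'} {p : E}
    (hL : ∀ᶠ y in 𝓝 p, ContDiffAt ℝ ∞ L y) (hs : ∀ᶠ y in 𝓝 p, ContDiffAt ℝ ∞ s y)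
    (hsurj : Function.Surjective (L p)) {a : E} (ha : L p a = s p) :
    ∃ X : E → E, X p = a ∧ ∀ᶠ y in 𝓝 p, ContDiffAt ℝ ∞ X y ∧ L y (X y) = s y := by
  obtain ⟨R, hR⟩ := (L p).exists_rightInverse_of_surjective (LinearMap.range_eq_top.2 hsurj)
  have hcont : ContinuousAt (fun y => (L y).comp R) p :=
    hL.self_of_nhds.continuousAt.clm_comp continuousAt_const
  have hunit : ∀ᶠ y in 𝓝 p, ((L y).comp R).IsInvertible := by
    have h1 : ((L p).comp R).IsInvertible := by
      rw [hR]; exact ⟨ContinuousLinearEquiv.refl ℝ E', rfl⟩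
    obtain ⟨B, hB⟩ := h1
    have := ContinuousLinearEquiv.nhds B
    rw [hB] at this
    exact hcont.eventually this
  -- The constant field `a` misses the target by `s y - L y a`; the right inverse `R` of `L p`,
  -- corrected by the inverse of `L y ∘ R`, removes this error. The correction is zero at `p`
  -- because `L p a = s p`.
  refine ⟨fun y => a + R (((L y).comp R).inverse (s y - L y a)), by simp [ha], ?_⟩
  filter_upwards [hL, hs, hunit] with y hLy hsy hy
  constructor
  · have hinv : ContDiffAt ℝ ∞ (fun z => ((L z).comp R).inverse) y := by
      obtain ⟨B, hB⟩ := hy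
      have h2 : ContDiffAt ℝ ∞ ContinuousLinearMap.inverse ((L y).comp R) := by
        rw [← hB]; exact contDiffAt_map_inverse B
      exact h2.comp y (hLy.clm_comp contDiffAt_const)
    exact contDiffAt_const.add (R.contDiff.contDiffAt.comp y
      (hinv.clm_apply (hsy.sub (hLy.clm_apply contDiffAt_const))))
  · have := hy.self_apply_inverse (s y - L y a)
    rw [ContinuousLinearMap.comp_apply] at this
    rw [map_add, this]
    abel

/-- The projections determined by two complementary smooth families of kernels are smooth. -/
theorem differentiableAt_of_complementary_kernels [FiniteDimensional ℝ E] [FiniteDimensional ℝ E']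
    (hdim : Module.finrank ℝ E = 2 * Module.finrank ℝ E')
    {A B : E → E →L[ℝ] E'} {P : E → E →L[ℝ] E} {p : E}
    (hA : ContDiffAt ℝ 1 A p) (hB : ContDiffAt ℝ 1 B p)
    (hinj : ∀ᶠ y in 𝓝 p, ∀ v, A y v = 0 → B y v = 0 → v = 0)
    (hAP : ∀ᶠ y in 𝓝 p, ∀ v, A y (P y v) = A y v) (hBP : ∀ᶠ y in 𝓝 p, ∀ v, B y (P y v) = 0) :
    DifferentiableAt ℝ P p := by
  -- The pair `(A, B)` is injective between spaces of equal dimension, hence invertible, and `P` is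
  -- then forced to be `(A, B)⁻¹ (A, 0)`.
  have hinv : ∀ᶠ y in 𝓝 p, ((A y).prod (B y)).IsInvertible := by
    filter_upwards [hinj] with y hy
    have hi : Function.Injective ((A y).prod (B y)).toLinearMap := by
      rw [← LinearMap.ker_eq_bot, LinearMap.ker_eq_bot']
      intro v hv
      exact hy v (congrArg Prod.fst hv) (congrArg Prod.snd hv)
    refine ⟨(LinearEquiv.ofInjectiveOfFinrankEq _ hi ?_).toContinuousLinearEquiv, ?_⟩
    · rw [hdim, Module.finrank_prod, two_mul]
    · ext v <;> rfl
  have hdiff : ContDiffAt ℝ 1 (fun y => ((A y).prod (B y)).inverse) p := by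
    obtain ⟨e, he⟩ := hinv.self_of_nhds
    have h2 : ContDiffAt ℝ 1 ContinuousLinearMap.inverse ((A p).prod (B p)) := by
      rw [← he]; exact contDiffAt_map_inverse e
    refine ContDiffAt.comp (g := ContinuousLinearMap.inverse)
      (f := fun y => (A y).prod (B y)) p h2 ?_
    have h3 : (fun y => (A y).prod (B y)) = fun y =>
        (ContinuousLinearMap.inl ℝ E' E').comp (A y) +
          (ContinuousLinearMap.inr ℝ E' E').comp (B y) := by
      funext y; ext v <;> simp
    rw [h3]
    exact (contDiffAt_const.clm_comp hA).add (contDiffAt_const.clm_comp hB)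
  have heq : P =ᶠ[𝓝 p] fun y =>
      ((A y).prod (B y)).inverse.comp ((ContinuousLinearMap.inl ℝ E' E').comp (A y)) := by
    filter_upwards [hinv, hAP, hBP] with y hy h1 h2
    ext v
    have : (ContinuousLinearMap.inl ℝ E' E') (A y v) = ((A y).prod (B y)) (P y v) := by
      simp [h1, h2]
    simp only [ContinuousLinearMap.comp_apply, this]
    rw [hy.inverse_apply_self]
  refine DifferentiableAt.congr_of_eventuallyEq ?_ heq
  exact (hdiff.clm_comp (contDiffAt_const.clm_comp hA)).differentiableAt (by simp)

end Calculus

/-! ### One-forms, tangent maps and exterior derivatives read in preferred charts -/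

section Charts

set_option linter.unusedSectionVars false

variable {E : Type*} [NormedAddCommGroup E] [NormedSpace ℝ E]
  {E' : Type*} [NormedAddCommGroup E'] [NormedSpace ℝ E']
  {M : Type*} [TopologicalSpace M] [ChartedSpace E M] [IsManifold 𝓘(ℝ, E) ∞ M]
  {N : Type*} [TopologicalSpace N] [ChartedSpace E' N] [IsManifold 𝓘(ℝ, E') ∞ N]

theorem tendsto_extChartAt_symm (x : M) :
    Filter.Tendsto (extChartAt 𝓘(ℝ, E) x).symm (𝓝 (extChartAt 𝓘(ℝ, E) x x)) (𝓝 x) := by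
  have := (continuousAt_extChartAt_symm (I := 𝓘(ℝ, E)) x).tendsto
  rwa [extChartAt_to_inv x] at this

theorem mdifferentiableAt_extChartAt_symm {x : M} {y : E}
    (hy : y ∈ (extChartAt 𝓘(ℝ, E) x).target) :
    MDifferentiableAt 𝓘(ℝ, E) 𝓘(ℝ, E) (extChartAt 𝓘(ℝ, E) x).symm y := by
  have := mdifferentiableWithinAt_extChartAt_symm hy
  rwa [modelWithCornersSelf_coe, Set.range_id, mdifferentiableWithinAt_univ] at this

theorem mfderiv_extChartAt_symm_apply {x : M} {y : M} (hy : y ∈ (extChartAt 𝓘(ℝ, E) x).source)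
    (v : TangentSpace 𝓘(ℝ, E) y) :
    mfderiv 𝓘(ℝ, E) 𝓘(ℝ, E) (extChartAt 𝓘(ℝ, E) x).symm (extChartAt 𝓘(ℝ, E) x y)
      (mfderiv 𝓘(ℝ, E) 𝓘(ℝ, E) (extChartAt 𝓘(ℝ, E) x) y v) = v := by
  have := mfderivWithin_extChartAt_symm_comp_mfderiv_extChartAt' hy
  rw [modelWithCornersSelf_coe, Set.range_id, mfderivWithin_univ] at this
  exact DFunLike.congr_fun this v

theorem mfderiv_extChartAt_apply_symm {x : M} {y : E} (hy : y ∈ (extChartAt 𝓘(ℝ, E) x).target)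
    (v : E) :
    mfderiv 𝓘(ℝ, E) 𝓘(ℝ, E) (extChartAt 𝓘(ℝ, E) x) ((extChartAt 𝓘(ℝ, E) x).symm y)
      (mfderiv 𝓘(ℝ, E) 𝓘(ℝ, E) (extChartAt 𝓘(ℝ, E) x).symm y v) = v := by
  have := mfderiv_extChartAt_comp_mfderivWithin_extChartAt_symm hy
  rw [modelWithCornersSelf_coe, Set.range_id, mfderivWithin_univ] at this
  exact DFunLike.congr_fun this v

/-- The preferred chart at `x` has the identity as derivative at `x`, so at the centre tangent
vectors coincide with their coordinates. -/
theorem mfderiv_extChartAt_symm_self (x : M) (v : E) :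
    mfderiv 𝓘(ℝ, E) 𝓘(ℝ, E) (extChartAt 𝓘(ℝ, E) x).symm (extChartAt 𝓘(ℝ, E) x x) v = v := by
  have := mfderiv_extChartAt_symm_apply (mem_extChartAt_source (I := 𝓘(ℝ, E)) x) v
  rwa [mfderiv_extChartAt_self] at this

theorem fderiv_writtenInExtChartAt {f : M → N} {x : M} {y : E}
    (hy : y ∈ (extChartAt 𝓘(ℝ, E) x).target)
    (hf : MDifferentiableAt 𝓘(ℝ, E) 𝓘(ℝ, E') f ((extChartAt 𝓘(ℝ, E) x).symm y))
    (hfy : f ((extChartAt 𝓘(ℝ, E) x).symm y) ∈ (extChartAt 𝓘(ℝ, E') (f x)).source) (v : E) :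
    fderiv ℝ (writtenInExtChartAt 𝓘(ℝ, E) 𝓘(ℝ, E') x f) y v =
      mfderiv 𝓘(ℝ, E') 𝓘(ℝ, E') (extChartAt 𝓘(ℝ, E') (f x)) (f ((extChartAt 𝓘(ℝ, E) x).symm y))
        (mfderiv 𝓘(ℝ, E) 𝓘(ℝ, E') f ((extChartAt 𝓘(ℝ, E) x).symm y)
          (mfderiv 𝓘(ℝ, E) 𝓘(ℝ, E) (extChartAt 𝓘(ℝ, E) x).symm y v)) := by
  rw [extChartAt_source] at hfy
  rw [← mfderiv_eq_fderiv, writtenInExtChartAt]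
  have h1 := mdifferentiableAt_extChartAt (I := 𝓘(ℝ, E')) hfy
  have h2 := mdifferentiableAt_extChartAt_symm hy
  rw [mfderiv_comp y h1 (hf.comp y h2), mfderiv_comp y hf h2]
  rfl

theorem eventually_chart {f : M → N} {x : M} (hf : ContinuousAt f x) :
    ∀ᶠ y in 𝓝 (extChartAt 𝓘(ℝ, E) x x), y ∈ (extChartAt 𝓘(ℝ, E) x).target ∧
      f ((extChartAt 𝓘(ℝ, E) x).symm y) ∈ (extChartAt 𝓘(ℝ, E') (f x)).source := by
  filter_upwards [extChartAt_target_mem_nhds (I := 𝓘(ℝ, E)) x,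
    (tendsto_extChartAt_symm x).eventually (hf.eventually
      (extChartAt_source_mem_nhds (I := 𝓘(ℝ, E')) (f x)))] with y h1 h2 using ⟨h1, h2⟩

theorem eventually_contDiffAt_writtenInExtChartAt {f : M → N} {x : M}
    (hf : ∀ᶠ x' in 𝓝 x, ContMDiffAt 𝓘(ℝ, E) 𝓘(ℝ, E') ∞ f x') :
    ∀ᶠ y in 𝓝 (extChartAt 𝓘(ℝ, E) x x),
      ContDiffAt ℝ ∞ (writtenInExtChartAt 𝓘(ℝ, E) 𝓘(ℝ, E') x f) y := by
  filter_upwards [eventually_chart (E := E) (E' := E') hf.self_of_nhds.continuousAt,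
    (tendsto_extChartAt_symm x).eventually hf] with y hy hfy
  rw [← contMDiffAt_iff_contDiffAt]
  have h1 : ContMDiffAt 𝓘(ℝ, E') 𝓘(ℝ, E') ∞ (extChartAt 𝓘(ℝ, E') (f x))
      (f ((extChartAt 𝓘(ℝ, E) x).symm y)) :=
    contMDiffAt_extChartAt' (by simpa using hy.2)
  have h2 : ContMDiffAt 𝓘(ℝ, E) 𝓘(ℝ, E) ∞ (extChartAt 𝓘(ℝ, E) x).symm y :=
    (contMDiffOn_extChartAt_symm x).contMDiffAt ((isOpen_extChartAt_target x).mem_nhds hy.1)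
  exact h1.comp y (hfy.comp y h2)

theorem oneFormInChart_mfderiv_apply (θ : ∀ x : M, TangentSpace 𝓘(ℝ, E) x →L[ℝ] ℝ) {x y : M}
    (hy : y ∈ (extChartAt 𝓘(ℝ, E) x).source) (v : TangentSpace 𝓘(ℝ, E) y) :
    oneFormInChart θ x (extChartAt 𝓘(ℝ, E) x y)
      (mfderiv 𝓘(ℝ, E) 𝓘(ℝ, E) (extChartAt 𝓘(ℝ, E) x) y v) = θ y v := by
  -- The points `φ⁻¹ (φ y)` and `y` are only propositionally equal. Since every tangent space
  -- unfolds to `E`, the base point can be made a variable and substituted while `u` stays fixed.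
  have key : ∀ (y' : M) (_ : y' = y) (u : E), θ y' u = θ y u := by
    rintro _ rfl u
    rfl
  exact (key _ ((extChartAt 𝓘(ℝ, E) x).left_inv hy) _).trans
    (congrArg (θ y) (mfderiv_extChartAt_symm_apply hy v))

/-- The coordinate expression of a pulled back one-form. -/
theorem oneFormInChart_pullback {θ : ∀ x : N, TangentSpace 𝓘(ℝ, E') x →L[ℝ] ℝ} {f : M → N} {x : M}
    (hf : ∀ᶠ x' in 𝓝 x, ContMDiffAt 𝓘(ℝ, E) 𝓘(ℝ, E') ∞ f x') :
    oneFormInChart (fun x' => (θ (f x')).comp (mfderiv 𝓘(ℝ, E) 𝓘(ℝ, E') f x')) x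
      =ᶠ[𝓝 (extChartAt 𝓘(ℝ, E) x x)]
      fun y => (oneFormInChart θ (f x) (writtenInExtChartAt 𝓘(ℝ, E) 𝓘(ℝ, E') x f y)).comp
        (fderiv ℝ (writtenInExtChartAt 𝓘(ℝ, E) 𝓘(ℝ, E') x f) y) := by
  filter_upwards [eventually_chart (E := E) (E' := E') hf.self_of_nhds.continuousAt,
    (tendsto_extChartAt_symm x).eventually hf] with y hy hfy
  ext v
  refine (oneFormInChart_mfderiv_apply θ hy.2 _).symm.trans ?_
  exact congrArg _ (fderiv_writtenInExtChartAt hy.1 (hfy.mdifferentiableAt (by simp)) hy.2 v).symm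

theorem oneFormInChart_pullback_differentiableAt
    {θ : ∀ x : N, TangentSpace 𝓘(ℝ, E') x →L[ℝ] ℝ} {f : M → N} {x : M}
    (hf : ∀ᶠ x' in 𝓝 x, ContMDiffAt 𝓘(ℝ, E) 𝓘(ℝ, E') ∞ f x')
    (hθ : DifferentiableAt ℝ (oneFormInChart θ (f x)) (extChartAt 𝓘(ℝ, E') (f x) (f x))) :
    DifferentiableAt ℝ
      (oneFormInChart (fun x' => (θ (f x')).comp (mfderiv 𝓘(ℝ, E) 𝓘(ℝ, E') f x')) x)
      (extChartAt 𝓘(ℝ, E) x x) := by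
  have hg : ContDiffAt ℝ ∞ (writtenInExtChartAt 𝓘(ℝ, E) 𝓘(ℝ, E') x f) (extChartAt 𝓘(ℝ, E) x x) :=
    (eventually_contDiffAt_writtenInExtChartAt hf).self_of_nhds
  refine DifferentiableAt.congr_of_eventuallyEq ?_ (oneFormInChart_pullback hf)
  have hp : writtenInExtChartAt 𝓘(ℝ, E) 𝓘(ℝ, E') x f (extChartAt 𝓘(ℝ, E) x x) =
      extChartAt 𝓘(ℝ, E') (f x) (f x) := by
    simp [writtenInExtChartAt]
  rw [← hp] at hθ
  have h1 := hg.differentiableAt (by simp)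
  have h2 := (hg.of_le (m := 2) ENat.LEInfty.out).fderiv_right (m := 1) (by norm_num)
  have h3 := h2.differentiableAt (by simp)
  exact (hθ.comp _ h1).clm_comp h3

theorem extDerivOneForm_eq (θ : ∀ x : M, TangentSpace 𝓘(ℝ, E) x →L[ℝ] ℝ) (x : M) (a b : E) :
    extDerivOneForm θ x a b =
      fderiv ℝ (oneFormInChart θ x) (extChartAt 𝓘(ℝ, E) x x) a b -
        fderiv ℝ (oneFormInChart θ x) (extChartAt 𝓘(ℝ, E) x x) b a := by
  simp only [extDerivOneForm, mfderiv_extChartAt_self]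
  rfl

theorem fderiv_writtenInExtChartAt_self {f : M → N} {x : M}
    (hf : MDifferentiableAt 𝓘(ℝ, E) 𝓘(ℝ, E') f x) (v : E) :
    fderiv ℝ (writtenInExtChartAt 𝓘(ℝ, E) 𝓘(ℝ, E') x f) (extChartAt 𝓘(ℝ, E) x x) v =
      mfderiv 𝓘(ℝ, E) 𝓘(ℝ, E') f x v := by
  have hx : (extChartAt 𝓘(ℝ, E) x).symm (extChartAt 𝓘(ℝ, E) x x) = x := extChartAt_to_inv x
  refine (fderiv_writtenInExtChartAt (mem_extChartAt_target x) (by rwa [hx])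
    (by rw [hx]; exact mem_extChartAt_source (f x)) _).trans ?_
  rw [mfderiv_extChartAt_symm_self, hx, mfderiv_extChartAt_self]
  rfl

/-- Near the centre, the pulled back form in coordinates is the Euclidean pullback under `f` written
in charts, so the identity is `fderiv_comp_fderiv_sub_swap`. At the centre the derivative of `f` in
charts is `mfderiv` itself, which removes the charts from the arguments. -/
theorem extDerivOneForm_pullback
    {θ : ∀ x : N, TangentSpace 𝓘(ℝ, E') x →L[ℝ] ℝ} {f : M → N} {x : M}
    (hf : ∀ᶠ x' in 𝓝 x, ContMDiffAt 𝓘(ℝ, E) 𝓘(ℝ, E') ∞ f x')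
    (hθ : DifferentiableAt ℝ (oneFormInChart θ (f x)) (extChartAt 𝓘(ℝ, E') (f x) (f x)))
    (a b : TangentSpace 𝓘(ℝ, E) x) :
    extDerivOneForm (fun x' => (θ (f x')).comp (mfderiv 𝓘(ℝ, E) 𝓘(ℝ, E') f x')) x a b =
      extDerivOneForm θ (f x) (mfderiv 𝓘(ℝ, E) 𝓘(ℝ, E') f x a)
        (mfderiv 𝓘(ℝ, E) 𝓘(ℝ, E') f x b) := by
  have hg : ContDiffAt ℝ ∞ (writtenInExtChartAt 𝓘(ℝ, E) 𝓘(ℝ, E') x f) (extChartAt 𝓘(ℝ, E) x x) :=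
    (eventually_contDiffAt_writtenInExtChartAt hf).self_of_nhds
  have hp : writtenInExtChartAt 𝓘(ℝ, E) 𝓘(ℝ, E') x f (extChartAt 𝓘(ℝ, E) x x) =
      extChartAt 𝓘(ℝ, E') (f x) (f x) := by
    simp [writtenInExtChartAt]
  have hm := hf.self_of_nhds.mdifferentiableAt (by simp)
  have hθ' := hθ
  rw [← hp] at hθ'
  refine (extDerivOneForm_eq (E := E) _ x a b).trans ?_
  rw [(oneFormInChart_pullback hf).fderiv_eq]
  have h1 := fderiv_comp_fderiv_sub_swap (hg.of_le (m := 2) ENat.LEInfty.out) hθ'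
  refine (h1 a b).trans ?_
  rw [hp]
  refine Eq.trans ?_ (extDerivOneForm_eq θ (f x) _ _).symm
  have h2 := fderiv_writtenInExtChartAt_self hm
  exact congrArg₂ (fun u v : E' =>
    fderiv ℝ (oneFormInChart θ (f x)) (extChartAt 𝓘(ℝ, E') (f x) (f x)) u v
    - fderiv ℝ (oneFormInChart θ (f x)) (extChartAt 𝓘(ℝ, E') (f x) (f x)) v u) (h2 a) (h2 b)

theorem extDerivOneForm_sub {θ η : ∀ x : M, TangentSpace 𝓘(ℝ, E) x →L[ℝ] ℝ} {x : M}
    (hθ : DifferentiableAt ℝ (oneFormInChart θ x) (extChartAt 𝓘(ℝ, E) x x))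
    (hη : DifferentiableAt ℝ (oneFormInChart η x) (extChartAt 𝓘(ℝ, E) x x))
    (a b : TangentSpace 𝓘(ℝ, E) x) :
    extDerivOneForm (fun x' => θ x' - η x') x a b =
      extDerivOneForm θ x a b - extDerivOneForm η x a b := by
  have h : oneFormInChart (fun x' => θ x' - η x') x =
      fun y => oneFormInChart θ x y - oneFormInChart η x y := rfl
  have e := extDerivOneForm_eq (E := E) (M := M)
  refine (e _ x a b).trans ?_
  refine Eq.trans ?_ (congrArg₂ (· - ·) (e θ x a b) (e η x a b)).symm
  rw [h, fderiv_fun_sub hθ hη]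
  exact sub_sub_sub_comm _ _ _ _

/-- The trivialization at `x` of the cotangent bundle composes `θ` with the derivative of the
inverse chart, which is how `oneFormInChart` is built; smoothness as a section therefore transfers.
-/
theorem IsSmoothOneForm.differentiableAt_oneFormInChart
    {θ : ∀ x : M, TangentSpace 𝓘(ℝ, E) x →L[ℝ] ℝ} (h : IsSmoothOneForm θ) (x : M) :
    DifferentiableAt ℝ (oneFormInChart θ x) (extChartAt 𝓘(ℝ, E) x x) := by
  have h1 := ((contMDiffAt_hom_bundle _).1 (h x)).2
  have h2 : ContMDiffAt 𝓘(ℝ, E) 𝓘(ℝ, E) ∞ (extChartAt 𝓘(ℝ, E) x).symm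
      (extChartAt 𝓘(ℝ, E) x x) :=
    (contMDiffOn_extChartAt_symm x).contMDiffAt (extChartAt_target_mem_nhds x)
  have h3 := h1.comp_of_eq h2 (extChartAt_to_inv x)
  rw [contMDiffAt_iff_contDiffAt] at h3
  refine (h3.differentiableAt (by simp)).congr_of_eventuallyEq ?_
  filter_upwards [extChartAt_target_mem_nhds (I := 𝓘(ℝ, E)) x] with y hy
  have hs := (extChartAt 𝓘(ℝ, E) x).map_target hy
  rw [extChartAt_source] at hs
  ext v
  simp only [oneFormInChart, Function.comp_apply, ContinuousLinearMap.inCoordinates,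
    ContinuousLinearMap.comp_apply]
  rw [TangentBundle.symmL_trivializationAt hs, modelWithCornersSelf_coe, Set.range_id,
    mfderivWithin_univ, (extChartAt 𝓘(ℝ, E) x).right_inv hy]
  simp
  rfl

end Charts

/-! ### Local sections of pulled back subbundles, and forms annihilating them -/

section Sections

set_option linter.unusedSectionVars false

variable {E : Type*} [NormedAddCommGroup E] [NormedSpace ℝ E]
  {E' : Type*} [NormedAddCommGroup E'] [NormedSpace ℝ E']
  {M : Type*} [TopologicalSpace M] [ChartedSpace E M] [IsManifold 𝓘(ℝ, E) ∞ M]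
  {N : Type*} [TopologicalSpace N] [ChartedSpace E' N] [IsManifold 𝓘(ℝ, E') ∞ N]

theorem eventually_nhds_extChartAt {x : M} {p : E → Prop} :
    (∀ᶠ y in 𝓝 (extChartAt 𝓘(ℝ, E) x x), p y) ↔ ∀ᶠ z in 𝓝 x, p (extChartAt 𝓘(ℝ, E) x z) := by
  rw [← map_extChartAt_nhds_of_boundaryless (I := 𝓘(ℝ, E)) x, Filter.eventually_map]

theorem fderiv_writtenInExtChartAt_mfderiv {f : M → N} {x z : M}
    (hz : z ∈ (extChartAt 𝓘(ℝ, E) x).source)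
    (hf : MDifferentiableAt 𝓘(ℝ, E) 𝓘(ℝ, E') f z)
    (hfz : f z ∈ (extChartAt 𝓘(ℝ, E') (f x)).source) (v : TangentSpace 𝓘(ℝ, E) z) :
    fderiv ℝ (writtenInExtChartAt 𝓘(ℝ, E) 𝓘(ℝ, E') x f) (extChartAt 𝓘(ℝ, E) x z)
        (mfderiv 𝓘(ℝ, E) 𝓘(ℝ, E) (extChartAt 𝓘(ℝ, E) x) z v) =
      mfderiv 𝓘(ℝ, E') 𝓘(ℝ, E') (extChartAt 𝓘(ℝ, E') (f x)) (f z)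
        (mfderiv 𝓘(ℝ, E) 𝓘(ℝ, E') f z v) := by
  have h := (extChartAt 𝓘(ℝ, E) x).left_inv hz
  refine (fderiv_writtenInExtChartAt ((extChartAt 𝓘(ℝ, E) x).map_source hz) (by rwa [h])
    (by rwa [h]) _).trans ?_
  rw [mfderiv_extChartAt_symm_apply hz, h]

theorem eventually_mem_sources {f : M → N} {x : M} (hf : ContinuousAt f x) :
    ∀ᶠ z in 𝓝 x, z ∈ (extChartAt 𝓘(ℝ, E) x).source ∧
      f z ∈ (extChartAt 𝓘(ℝ, E') (f x)).source := by
  filter_upwards [extChartAt_source_mem_nhds (I := 𝓘(ℝ, E)) x,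
    hf.eventually (extChartAt_source_mem_nhds (I := 𝓘(ℝ, E')) (f x))] with z h1 h2 using ⟨h1, h2⟩

/-- Bridge between smoothness in the tangent bundle, expressed by trivializations, and smoothness of
coordinate expressions, expressed by derivatives of charts. -/
theorem trivializationAt_snd_eq_mfderiv {x z : M} (hz : z ∈ (extChartAt 𝓘(ℝ, E) x).source)
    (v : TangentSpace 𝓘(ℝ, E) z) :
    (trivializationAt E (TangentSpace 𝓘(ℝ, E)) x ⟨z, v⟩).2 =
      mfderiv 𝓘(ℝ, E) 𝓘(ℝ, E) (extChartAt 𝓘(ℝ, E) x) z v := by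
  rw [extChartAt_source] at hz
  refine Eq.trans ?_
    (DFunLike.congr_fun (TangentBundle.continuousLinearMapAt_trivializationAt hz) v)
  exact (congrFun ((trivializationAt E (TangentSpace 𝓘(ℝ, E)) x).coe_linearMapAt_of_mem
    (R := ℝ) (by simpa using hz)) v).symm

/-- A tangent vector mapped by a submersion `f` into a subbundle of `f^*(TN)` extends to a local
vector field with the same property. -/
theorem exists_isLocalSection_comap [FiniteDimensional ℝ E] [FiniteDimensional ℝ E']
    {f : M → N} (hf : ContMDiff 𝓘(ℝ, E) 𝓘(ℝ, E') ∞ f)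
    {K : ∀ x : M, Submodule ℝ (TangentSpace 𝓘(ℝ, E') (f x))}
    (hK : IsSmoothSubbundleOn (E := E) f Set.univ K) {x : M}
    (hsurj : Function.Surjective (mfderiv 𝓘(ℝ, E) 𝓘(ℝ, E') f x))
    {a : TangentSpace 𝓘(ℝ, E) x} (ha : mfderiv 𝓘(ℝ, E) 𝓘(ℝ, E') f x a ∈ K x) :
    ∃ X, IsLocalSection
      (fun z => (K z).comap (mfderiv 𝓘(ℝ, E) 𝓘(ℝ, E') f z).toLinearMap) x X ∧ X x = a := by
  obtain ⟨U, hU, hxU, r, e, he, hspan⟩ := hK x (Set.mem_univ x)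
  rw [Set.univ_inter] at he hspan
  rw [← (hspan x hxU).2, Submodule.mem_span_range_iff_exists_fun] at ha
  obtain ⟨c, hc⟩ := ha
  set φ := extChartAt 𝓘(ℝ, E) x with hφ
  set ψ := extChartAt 𝓘(ℝ, E') (f x) with hψ
  have hsrc := eventually_mem_sources (E := E) (E' := E') hf.continuous.continuousAt (x := x)
  let t : Fin r → M → E' := fun j z => mfderiv 𝓘(ℝ, E') 𝓘(ℝ, E') ψ (f z) (e j z)
  have ht : ∀ j, ∀ᶠ z in 𝓝 x, ContMDiffAt 𝓘(ℝ, E) 𝓘(ℝ, E') ∞ (t j) z := by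
    intro j
    filter_upwards [hsrc.eventually_nhds, hU.mem_nhds hxU] with z hz hzU
    have h1 := (he j).contMDiffAt (hU.mem_nhds hzU)
    have h2 : (⟨f z, e j z⟩ : TangentBundle 𝓘(ℝ, E') N) ∈
        (trivializationAt E' (TangentSpace 𝓘(ℝ, E')) (f x)).source := by
      rw [Bundle.Trivialization.mem_source]
      simpa using hz.self_of_nhds.2
    have h3 := ((Bundle.Trivialization.contMDiffAt_iff (IB := 𝓘(ℝ, E'))
      (f := fun y => (⟨f y, e j y⟩ : TangentBundle 𝓘(ℝ, E') N)) h2).1 h1).2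
    refine h3.congr_of_eventuallyEq ?_
    filter_upwards [hz] with w hw
    exact (trivializationAt_snd_eq_mfderiv hw.2 _).symm
  -- The image of `a` under `Tf` is `∑ c j • e j x`. Keeping the coefficients `c j` constant extends
  -- it to a section of `K` along `f`, here in coordinates; surjectivity of `Tf` then lets this
  -- section be lifted to a field through `a`.
  let s : E → E' := fun y => ∑ j, c j • t j (φ.symm y)
  have hs : ∀ᶠ y in 𝓝 (φ x), ContDiffAt ℝ ∞ s y := by
    filter_upwards [(tendsto_extChartAt_symm x).eventually (Filter.eventually_all.2 ht),
      extChartAt_target_mem_nhds (I := 𝓘(ℝ, E)) x] with y hy hy'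
    refine ContDiffAt.sum fun j _ => contDiffAt_const.smul ?_
    rw [← contMDiffAt_iff_contDiffAt]
    exact (hy j).comp y ((contMDiffOn_extChartAt_symm x).contMDiffAt
      ((isOpen_extChartAt_target x).mem_nhds hy'))
  have hsz : ∀ z ∈ φ.source, s (φ z) =
      mfderiv 𝓘(ℝ, E') 𝓘(ℝ, E') ψ (f z) (∑ j, c j • e j z) := by
    intro z hz
    change ∑ j, c j • t j (φ.symm (φ z)) = _
    rw [φ.left_inv hz, map_sum]
    simp only [map_smul]
    rfl
  have hg := eventually_contDiffAt_writtenInExtChartAt (x := x) (Filter.Eventually.of_forall hf)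
  have hdf : ∀ z, MDifferentiableAt 𝓘(ℝ, E) 𝓘(ℝ, E') f z :=
    fun z => (hf z).mdifferentiableAt (by simp)
  have hL : ∀ᶠ y in 𝓝 (φ x),
      ContDiffAt ℝ ∞ (fderiv ℝ (writtenInExtChartAt 𝓘(ℝ, E) 𝓘(ℝ, E') x f)) y := by
    filter_upwards [hg] with y hy
    exact hy.fderiv_right (m := ∞) le_rfl
  have hself := fderiv_writtenInExtChartAt_self (hdf x)
  obtain ⟨X, hXx, hX⟩ := exists_contDiffAt_lift (a := a) hL hs
    (fun w => by
      obtain ⟨u, hu⟩ := hsurj w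
      exact ⟨u, (hself u).trans hu⟩)
    (by
      refine (hself a).trans ?_
      rw [hsz x (mem_extChartAt_source x), hψ, mfderiv_extChartAt_self, hc]
      rfl)
  rw [eventually_nhds_extChartAt] at hX
  have hdφX : ∀ z ∈ φ.source, mfderiv 𝓘(ℝ, E) 𝓘(ℝ, E) φ z
      (mfderiv 𝓘(ℝ, E) 𝓘(ℝ, E) φ.symm (φ z) (X (φ z))) = X (φ z) := by
    intro z hz
    have := mfderiv_extChartAt_apply_symm (φ.map_source hz) (X (φ z))
    rwa [φ.left_inv hz] at this
  have key : ∀ᶠ z in 𝓝 x,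
      ContMDiffAt 𝓘(ℝ, E) 𝓘(ℝ, E).tangent ∞ (fun z =>
        (⟨z, mfderiv 𝓘(ℝ, E) 𝓘(ℝ, E) φ.symm (φ z) (X (φ z))⟩ : TangentBundle 𝓘(ℝ, E) M)) z ∧
      mfderiv 𝓘(ℝ, E) 𝓘(ℝ, E') f z (mfderiv 𝓘(ℝ, E) 𝓘(ℝ, E) φ.symm (φ z) (X (φ z))) ∈ K z := by
    filter_upwards [hX, hsrc, hU.mem_nhds hxU] with z hz hzs hzU
    constructor
    · refine (Bundle.Trivialization.contMDiffAt_section_iff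
        (trivializationAt E (TangentSpace 𝓘(ℝ, E)) x) (by simpa using hzs.1)).2 ?_
      have h1 : ContMDiffAt 𝓘(ℝ, E) 𝓘(ℝ, E) ∞ (fun w => X (φ w)) z :=
        hz.1.contMDiffAt.comp z (contMDiffAt_extChartAt' (by simpa using hzs.1))
      refine h1.congr_of_eventuallyEq ?_
      filter_upwards [(isOpen_extChartAt_source (I := 𝓘(ℝ, E)) x).mem_nhds hzs.1] with w hw
      exact (trivializationAt_snd_eq_mfderiv hw _).trans (hdφX w hw)
    · have h1 := fderiv_writtenInExtChartAt_mfderiv hzs.1 (hdf z) hzs.2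
        (mfderiv 𝓘(ℝ, E) 𝓘(ℝ, E) φ.symm (φ z) (X (φ z)))
      rw [hdφX z hzs.1] at h1
      -- The lifting equation holds in coordinates; injectivity of the derivative of the chart `ψ`
      -- on `N` brings it back to `T_{f z} N`, where the right side is a combination of the frame.
      have h2 := h1.symm.trans (hz.2.trans (hsz z hzs.1))
      rw [(isInvertible_mfderiv_extChartAt hzs.2).injective h2, ← (hspan z hzU).2]
      exact Submodule.sum_smul_mem _ _ fun j _ => Submodule.subset_span ⟨j, rfl⟩
  obtain ⟨W, hW, hWo, hxW⟩ := eventually_nhds_iff.1 key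
  refine ⟨fun z => mfderiv 𝓘(ℝ, E) 𝓘(ℝ, E) φ.symm (φ z) (X (φ z)), ⟨W, hWo, hxW,
    fun z hz => (hW z hz).1.contMDiffWithinAt, fun z hz => (hW z hz).2⟩, ?_⟩
  exact (mfderiv_extChartAt_symm_self x _).trans hXx

/-- A one-form annihilating two vector fields and, at `x`, their bracket has exterior derivative
zero on their values at `x`. -/
theorem extDerivOneForm_eq_zero_of_annihilates [FiniteDimensional ℝ E]
    {α : ∀ x : M, TangentSpace 𝓘(ℝ, E) x →L[ℝ] ℝ} {x : M}
    (hα : DifferentiableAt ℝ (oneFormInChart α x) (extChartAt 𝓘(ℝ, E) x x))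
    {X Y : ∀ z : M, TangentSpace 𝓘(ℝ, E) z}
    (hX : ContMDiffAt 𝓘(ℝ, E) 𝓘(ℝ, E).tangent ∞
      (fun z => (⟨z, X z⟩ : TangentBundle 𝓘(ℝ, E) M)) x)
    (hY : ContMDiffAt 𝓘(ℝ, E) 𝓘(ℝ, E).tangent ∞
      (fun z => (⟨z, Y z⟩ : TangentBundle 𝓘(ℝ, E) M)) x)
    (hαX : ∀ᶠ z in 𝓝 x, α z (X z) = 0) (hαY : ∀ᶠ z in 𝓝 x, α z (Y z) = 0)
    (hbr : α x (VectorField.mlieBracket 𝓘(ℝ, E) X Y x) = 0) :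
    extDerivOneForm α x (X x) (Y x) = 0 := by
  let pb : (∀ z : M, TangentSpace 𝓘(ℝ, E) z) → E → E := fun Z =>
    VectorField.mpullbackWithin 𝓘(ℝ, E) 𝓘(ℝ, E) (extChartAt 𝓘(ℝ, E) x).symm Z (Set.range 𝓘(ℝ, E))
  have hx : (extChartAt 𝓘(ℝ, E) x).symm (extChartAt 𝓘(ℝ, E) x x) = x := extChartAt_to_inv x
  have hd : ∀ Z : (∀ z : M, TangentSpace 𝓘(ℝ, E) z), ContMDiffAt 𝓘(ℝ, E) 𝓘(ℝ, E).tangent ∞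
      (fun z => (⟨z, Z z⟩ : TangentBundle 𝓘(ℝ, E) M)) x →
      DifferentiableAt ℝ (pb Z) (extChartAt 𝓘(ℝ, E) x x) := by
    intro Z hZ
    have h1 := VectorField.contMDiffWithinAt_mpullbackWithin_extChartAt_symm (m := 1) (n := ∞)
      ((hZ.of_le (by simp)).contMDiffWithinAt (s := Set.univ)) uniqueMDiffOn_univ
      (Set.mem_univ x) (by rw [one_add_one_eq_two]; exact ENat.LEInfty.out)
    rw [Set.preimage_univ, Set.inter_univ] at h1
    exact ((contMDiffWithinAt_vectorSpace_iff_contDiffWithinAt.1 h1).contDiffAt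
      (extChartAt_target_mem_nhds x)).differentiableAt one_ne_zero
  have hz : ∀ Z : (∀ z : M, TangentSpace 𝓘(ℝ, E) z), (∀ᶠ z in 𝓝 x, α z (Z z) = 0) →
      ∀ᶠ y in 𝓝 (extChartAt 𝓘(ℝ, E) x x), oneFormInChart α x y (pb Z y) = 0 := by
    intro Z hZ
    filter_upwards [extChartAt_target_mem_nhds (I := 𝓘(ℝ, E)) x,
      (tendsto_extChartAt_symm x).eventually hZ] with y hy hyZ
    have h1 := (isInvertible_mfderivWithin_extChartAt_symm hy).self_apply_inverse
      (Z ((extChartAt 𝓘(ℝ, E) x).symm y))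
    refine Eq.trans (congrArg (α ((extChartAt 𝓘(ℝ, E) x).symm y)) ?_) hyZ
    refine Eq.trans ?_ h1
    rw [modelWithCornersSelf_coe, Set.range_id, mfderivWithin_univ]
    simp only [pb, VectorField.mpullbackWithin_apply]
    rw [modelWithCornersSelf_coe, Set.range_id, mfderivWithin_univ]
    rfl
  have hv : ∀ Z : (∀ z : M, TangentSpace 𝓘(ℝ, E) z), pb Z (extChartAt 𝓘(ℝ, E) x x) = Z x := by
    intro Z
    have h1 := mfderivWithin_extChartAt_symm_inverse_apply (I := 𝓘(ℝ, E)) (Z x)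
    refine Eq.trans ?_ h1
    simp only [pb, VectorField.mpullbackWithin_apply]
    rw [hx]
  have hαx : ∀ v : E, oneFormInChart α x (extChartAt 𝓘(ℝ, E) x x) v = α x v := by
    intro v
    have := oneFormInChart_mfderiv_apply α (mem_extChartAt_source (I := 𝓘(ℝ, E)) x) v
    rwa [mfderiv_extChartAt_self] at this
  have hbr' : oneFormInChart α x (extChartAt 𝓘(ℝ, E) x x)
      (VectorField.lieBracket ℝ (pb X) (pb Y) (extChartAt 𝓘(ℝ, E) x x)) = 0 := by
    have hset : (extChartAt 𝓘(ℝ, E) x).symm ⁻¹' Set.univ ∩ Set.range 𝓘(ℝ, E) = Set.univ := by simp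
    -- The manifold bracket is computed in this very chart, whose derivative at `x` is the identity,
    -- so no transport of the Euclidean bracket remains.
    have h1 : VectorField.mlieBracket 𝓘(ℝ, E) X Y x =
        VectorField.lieBracket ℝ (pb X) (pb Y) (extChartAt 𝓘(ℝ, E) x x) := by
      rw [← VectorField.mlieBracketWithin_univ, VectorField.mlieBracketWithin_apply, hset,
        mfderiv_extChartAt_self]
      refine (DFunLike.congr_fun (ContinuousLinearMap.inverse_id (R := ℝ) (M := E)) _).trans ?_
      exact congrFun VectorField.lieBracketWithin_univ _
    rw [h1] at hbr
    exact (hαx _).trans hbr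
  have := fderiv_sub_swap_eq_zero_of_annihilates hα (hd X hX) (hd Y hY) (hz X hαX) (hz Y hαY) hbr'
  rw [hv, hv] at this
  exact (extDerivOneForm_eq α x _ _).trans this

end Sections

section Discrete

set_option linter.unusedSectionVars false

variable {EQ : Type*} [NormedAddCommGroup EQ] [NormedSpace ℝ EQ] [FiniteDimensional ℝ EQ]
  {Q : Type*} [TopologicalSpace Q] [ChartedSpace EQ Q] [IsManifold 𝓘(ℝ, EQ) ∞ Q]
  {EV : Type*} [NormedAddCommGroup EV] [NormedSpace ℝ EV] [FiniteDimensional ℝ EV]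
  {V : Type*} [TopologicalSpace V] [ChartedSpace EV V] [IsManifold 𝓘(ℝ, EV) ∞ V]
  {ED : Type*} [NormedAddCommGroup ED] [NormedSpace ℝ ED] [FiniteDimensional ℝ ED]
  {D : Type*} [TopologicalSpace D] [ChartedSpace ED D] [IsManifold 𝓘(ℝ, ED) ∞ D]

/-! ### The splitting of `TV` and its differentiability -/

namespace DiscreteTangentBundle

variable (T : DiscreteTangentBundle EQ Q EV V)

theorem plusPart_add_minusPart (v : V) (a : TangentSpace 𝓘(ℝ, EV) v) :
    T.plusPart v a + T.minusPart v a = a :=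
  Submodule.projection_add_projection_eq_self (T.isCompl_vert v) a

theorem dMinus_plusPart (v : V) (a : TangentSpace 𝓘(ℝ, EV) v) :
    T.dMinus v (T.plusPart v a) = 0 :=
  Submodule.projection_apply_mem (T.isCompl_vert v) a

theorem dPlus_minusPart (v : V) (a : TangentSpace 𝓘(ℝ, EV) v) :
    T.dPlus v (T.minusPart v a) = 0 :=
  Submodule.projection_apply_mem (T.isCompl_vert v).symm a

theorem dPlus_plusPart (v : V) (a : TangentSpace 𝓘(ℝ, EV) v) :
    T.dPlus v (T.plusPart v a) = T.dPlus v a := by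
  conv_rhs => rw [← T.plusPart_add_minusPart v a, map_add, dPlus_minusPart, add_zero]

theorem dMinus_minusPart (v : V) (a : TangentSpace 𝓘(ℝ, EV) v) :
    T.dMinus v (T.minusPart v a) = T.dMinus v a := by
  conv_rhs => rw [← T.plusPart_add_minusPart v a, map_add, dMinus_plusPart, zero_add]

theorem contMDiff_plus : ContMDiff 𝓘(ℝ, EV) 𝓘(ℝ, EQ) ∞ T.plus :=
  T.plus_submersion.contMDiff

theorem contMDiff_minus : ContMDiff 𝓘(ℝ, EV) 𝓘(ℝ, EQ) ∞ T.minus :=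
  T.minus_submersion.contMDiff

/-- The coordinate expression of the projection `δv ↦ δv⁺`. -/
noncomputable def plusPartInChart (p : V) (y : EV) : EV →L[ℝ] EV :=
  (mfderiv 𝓘(ℝ, EV) 𝓘(ℝ, EV) (extChartAt 𝓘(ℝ, EV) p) ((extChartAt 𝓘(ℝ, EV) p).symm y)).comp
    ((T.plusPart ((extChartAt 𝓘(ℝ, EV) p).symm y)).comp
      (mfderiv 𝓘(ℝ, EV) 𝓘(ℝ, EV) (extChartAt 𝓘(ℝ, EV) p).symm y))

theorem plusPartInChart_apply {p z : V} (hz : z ∈ (extChartAt 𝓘(ℝ, EV) p).source)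
    (v : TangentSpace 𝓘(ℝ, EV) z) :
    T.plusPartInChart p (extChartAt 𝓘(ℝ, EV) p z)
        (mfderiv 𝓘(ℝ, EV) 𝓘(ℝ, EV) (extChartAt 𝓘(ℝ, EV) p) z v) =
      mfderiv 𝓘(ℝ, EV) 𝓘(ℝ, EV) (extChartAt 𝓘(ℝ, EV) p) z (T.plusPart z v) := by
  have key : ∀ (z' : V) (_ : z' = z) (u : EV),
      (mfderiv 𝓘(ℝ, EV) 𝓘(ℝ, EV) (extChartAt 𝓘(ℝ, EV) p) z' (T.plusPart z' u) : EV) =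
        mfderiv 𝓘(ℝ, EV) 𝓘(ℝ, EV) (extChartAt 𝓘(ℝ, EV) p) z (T.plusPart z u) := by
    rintro _ rfl u
    rfl
  exact (key _ ((extChartAt 𝓘(ℝ, EV) p).left_inv hz) _).trans
    (congrArg (fun u => mfderiv 𝓘(ℝ, EV) 𝓘(ℝ, EV) (extChartAt 𝓘(ℝ, EV) p) z (T.plusPart z u))
      (mfderiv_extChartAt_symm_apply hz v))

/-- The splitting is defined pointwise by linear algebra, so its regularity has to be proved: `δv⁺`
is the unique vector with the same `T∂⁺` as `δv` and zero `T∂⁻`, and both tangent maps are smooth in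
charts. -/
theorem differentiableAt_plusPartInChart (p : V) :
    DifferentiableAt ℝ (T.plusPartInChart p) (extChartAt 𝓘(ℝ, EV) p p) := by
  have h : ∀ {f : V → Q}, ContMDiff 𝓘(ℝ, EV) 𝓘(ℝ, EQ) ∞ f → ContDiffAt ℝ 1
      (fderiv ℝ (writtenInExtChartAt 𝓘(ℝ, EV) 𝓘(ℝ, EQ) p f)) (extChartAt 𝓘(ℝ, EV) p p) := by
    intro f hf
    have hg : ContDiffAt ℝ ∞ (writtenInExtChartAt 𝓘(ℝ, EV) 𝓘(ℝ, EQ) p f)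
        (extChartAt 𝓘(ℝ, EV) p p) :=
      (eventually_contDiffAt_writtenInExtChartAt (Filter.Eventually.of_forall hf)).self_of_nhds
    exact (hg.of_le (m := 2) ENat.LEInfty.out).fderiv_right (m := 1) (by norm_num)
  have hp := T.contMDiff_plus
  have hm := T.contMDiff_minus
  have hdp : ∀ z, MDifferentiableAt 𝓘(ℝ, EV) 𝓘(ℝ, EQ) T.plus z :=
    fun z => (hp z).mdifferentiableAt (by simp)
  have hdm : ∀ z, MDifferentiableAt 𝓘(ℝ, EV) 𝓘(ℝ, EQ) T.minus z :=
    fun z => (hm z).mdifferentiableAt (by simp)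
  have hsp := eventually_mem_sources (E := EV) (E' := EQ) (x := p) hp.continuous.continuousAt
  have hsm := eventually_mem_sources (E := EV) (E' := EQ) (x := p) hm.continuous.continuousAt
  refine differentiableAt_of_complementary_kernels T.finrank_eq (h hp) (h hm) ?_ ?_ ?_ <;>
  · rw [eventually_nhds_extChartAt]
    filter_upwards [hsp, hsm] with z hzp hzm v
    obtain ⟨w, rfl⟩ := (isInvertible_mfderiv_extChartAt hzp.1).surjective v
    have e1 := fderiv_writtenInExtChartAt_mfderiv hzp.1 (hdp z) hzp.2
    have e2 := fderiv_writtenInExtChartAt_mfderiv hzm.1 (hdm z) hzm.2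
    have i1 := (isInvertible_mfderiv_extChartAt hzp.2).injective
    have i2 := (isInvertible_mfderiv_extChartAt hzm.2).injective
    -- The alternatives match the three conditions on the kernels: trivial intersection, `T∂⁺`
    -- unchanged by the projection, `T∂⁻` killed by it.
    first
    | intro h1 h2
      have h1' := i1 ((e1 w).symm.trans (h1.trans (map_zero _).symm))
      have h2' := i2 ((e2 w).symm.trans (h2.trans (map_zero _).symm))
      rw [T.ker_inf_ker z w h1' h2', map_zero]
      rfl
    | rw [T.plusPartInChart_apply hzp.1]
      refine (e1 _).trans (Eq.trans ?_ (e1 _).symm)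
      exact congrArg _ (T.dPlus_plusPart z w)
    | rw [T.plusPartInChart_apply hzp.1]
      refine (e2 _).trans ?_
      rw [T.dMinus_plusPart z w, map_zero]
      rfl

end DiscreteTangentBundle

/-! ### The forms `θ±`, sections of `𝒦⁺` and the defect of an evolution map -/

namespace DCLS

variable (S : DCLS EQ Q EV V ED D)

theorem differentiableAt_θPlus (p : V) :
    DifferentiableAt ℝ (oneFormInChart S.θPlus p) (extChartAt 𝓘(ℝ, EV) p p) := by
  refine ((S.smooth_σ.differentiableAt_oneFormInChart p).clm_comp
    (S.differentiableAt_plusPartInChart p)).congr_of_eventuallyEq ?_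
  rw [Filter.EventuallyEq, eventually_nhds_extChartAt]
  filter_upwards [extChartAt_source_mem_nhds (I := 𝓘(ℝ, EV)) p] with z hz
  ext v
  obtain ⟨w, rfl⟩ := (isInvertible_mfderiv_extChartAt hz).surjective v
  refine (oneFormInChart_mfderiv_apply S.θPlus hz w).trans ?_
  refine (oneFormInChart_mfderiv_apply S.σ hz (S.plusPart z w)).symm.trans ?_
  exact congrArg _ (S.plusPartInChart_apply hz w).symm

/-- This is `σ` applied to `δv = δv⁺ + δv⁻`. It yields both the regularity of `θ⁻` and the relation
`ω⁺ - ω⁻ = -dσ`. -/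
theorem θMinus_eq : S.θMinus = fun v => S.θPlus v - S.σ v := by
  funext v
  ext a
  have h := congrArg (S.σ v) (S.plusPart_add_minusPart v a)
  rw [map_add] at h
  change -(S.σ v (S.minusPart v a)) = S.σ v (S.plusPart v a) - S.σ v a
  linarith

theorem differentiableAt_θMinus (p : V) :
    DifferentiableAt ℝ (oneFormInChart S.θMinus p) (extChartAt 𝓘(ℝ, EV) p p) := by
  rw [θMinus_eq]
  exact (S.differentiableAt_θPlus p).sub (S.smooth_σ.differentiableAt_oneFormInChart p)

theorem ωPlus_eq_ωMinus {v : V} {a b : TangentSpace 𝓘(ℝ, EV) v}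
    (h : extDerivOneForm S.σ v a b = 0) : S.ωPlus v a b = S.ωMinus v a b := by
  have h1 := extDerivOneForm_sub (S.differentiableAt_θPlus v)
    (S.smooth_σ.differentiableAt_oneFormInChart v) a b
  rw [h, sub_zero, ← θMinus_eq] at h1
  rw [ωPlus, ωMinus, h1]

theorem contMDiff_incl : ContMDiff 𝓘(ℝ, ED) 𝓘(ℝ, EV) ∞ S.incl :=
  S.incl_embedding.isImmersion.contMDiff

theorem mfderiv_plus_comp_incl (x : D) :
    mfderiv 𝓘(ℝ, ED) 𝓘(ℝ, EQ) (fun z => S.plus (S.incl z)) x =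
      (S.dPlus (S.incl x)).comp (S.dIncl x) :=
  mfderiv_comp x ((S.contMDiff_plus _).mdifferentiableAt (by simp))
    ((S.contMDiff_incl x).mdifferentiableAt (by simp))

theorem KPlus_eq : S.KPlus = fun x => (S.ℰ x).comap
    (mfderiv 𝓘(ℝ, ED) 𝓘(ℝ, EQ) (fun z => S.plus (S.incl z)) x).toLinearMap := by
  funext x
  rw [mfderiv_plus_comp_incl]
  rfl

/-- Holds because `∂⁺` restricted to `𝒟` is a submersion and `ℰ` has smooth local frames. It ensures
that `curvature` on `𝒦⁺` is given by a bracket and not by its default value. -/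
theorem exists_isLocalSection_KPlus {x : D} {a : TangentSpace 𝓘(ℝ, ED) x} (ha : a ∈ S.KPlus x) :
    ∃ X, IsLocalSection S.KPlus x X ∧ X x = a := by
  rw [KPlus_eq] at ha ⊢
  exact exists_isLocalSection_comap S.plus_incl_submersion.contMDiff S.smooth_ℰ
    (surjective_mfderiv_of_isSubmersionAt (S.plus_incl_submersion.isSubmersionAt x)) ha

/-- Along an evolution map `F`, the form `θ⁺ - F^*θ⁻` on `𝒟`. -/
noncomputable def defect (F : D → D) (x : D) : TangentSpace 𝓘(ℝ, ED) x →L[ℝ] ℝ :=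
  (S.θPlus (S.incl x)).comp (mfderiv 𝓘(ℝ, ED) 𝓘(ℝ, EV) S.incl x) -
    (S.θMinus ((S.incl ∘ F) x)).comp (mfderiv 𝓘(ℝ, ED) 𝓘(ℝ, EV) (S.incl ∘ F) x)

variable {S} {U : Set D} {F : D → D}

theorem IsEvolutionMap.contMDiffAt (hF : S.IsEvolutionMap U F) {x : D} (hx : x ∈ U) :
    ContMDiffAt 𝓘(ℝ, ED) 𝓘(ℝ, ED) ∞ F x :=
  hF.smooth.contMDiffAt (hF.isOpen.mem_nhds hx)

/-- The discrete Lagrange-d'Alembert principle in the language of forms: the variations to test with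
are the plus part of `a` at `x` and the minus part of its image at `F x`. -/
theorem IsEvolutionMap.defect_apply_eq_zero (hF : S.IsEvolutionMap U F) {x : D} (hx : x ∈ U)
    {a : TangentSpace 𝓘(ℝ, ED) x} (ha : a ∈ S.KPlus x) : S.defect F x a = 0 := by
  have hi : ∀ y, MDifferentiableAt 𝓘(ℝ, ED) 𝓘(ℝ, EV) S.incl y :=
    fun y => (S.contMDiff_incl y).mdifferentiableAt (by simp)
  have hp : ∀ y, MDifferentiableAt 𝓘(ℝ, EV) 𝓘(ℝ, EQ) S.plus y :=
    fun y => (S.contMDiff_plus y).mdifferentiableAt (by simp)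
  have hm : ∀ y, MDifferentiableAt 𝓘(ℝ, EV) 𝓘(ℝ, EQ) S.minus y :=
    fun y => (S.contMDiff_minus y).mdifferentiableAt (by simp)
  have hiF : MDifferentiableAt 𝓘(ℝ, ED) 𝓘(ℝ, EV) (S.incl ∘ F) x :=
    (hi (F x)).comp x ((hF.contMDiffAt hx).mdifferentiableAt (by simp))
  set b := mfderiv 𝓘(ℝ, ED) 𝓘(ℝ, EV) (S.incl ∘ F) x a with hb
  -- Derivative of `∂⁺ = ∂⁻ ∘ F`, which holds on the open set `U`. Since the base points agree only
  -- propositionally, it is stated in the total space of `TQ`.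
  have hfirst : tangentMap 𝓘(ℝ, EV) 𝓘(ℝ, EQ) S.plus ⟨S.incl x, S.dIncl x a⟩ =
      tangentMap 𝓘(ℝ, EV) 𝓘(ℝ, EQ) S.minus ⟨S.incl (F x), b⟩ := by
    have heq : S.plus ∘ S.incl =ᶠ[𝓝 x] S.minus ∘ (S.incl ∘ F) := by
      filter_upwards [hF.isOpen.mem_nhds hx] with y hy
      exact (hF.isSolutionPair y hy).first_order
    have h1 : tangentMap 𝓘(ℝ, ED) 𝓘(ℝ, EQ) (S.plus ∘ S.incl) ⟨x, a⟩ =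
        tangentMap 𝓘(ℝ, ED) 𝓘(ℝ, EQ) (S.minus ∘ (S.incl ∘ F)) ⟨x, a⟩ := by
      refine Bundle.TotalSpace.ext heq.self_of_nhds ?_
      simp only [tangentMap]
      rw [heq.mfderiv_eq]
      rfl
    rwa [tangentMap_comp_at _ (hp _) (hi _), tangentMap_comp_at _ (hm _) hiF] at h1
  have hcrit := (hF.isSolutionPair x hx).critical (S.plusPart _ (S.dIncl x a)) (S.minusPart _ b)
    (by
      simp only [tangentMap] at hfirst ⊢
      rw [S.dPlus_plusPart]
      refine hfirst.trans ?_
      exact congrArg _ (S.dMinus_minusPart _ b).symm)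
    (S.dMinus_plusPart _ _) (S.dPlus_minusPart _ _)
    (by rw [S.dPlus_plusPart]; exact ha)
  -- The sign in the definition of `θ⁻` turns the sum in the principle into the difference in
  -- `defect`.
  change S.σ _ (S.plusPart _ (S.dIncl x a)) - -(S.σ _ (S.minusPart _ b)) = 0
  rw [sub_neg_eq_add]
  exact hcrit

theorem IsEvolutionMap.eventually_contMDiffAt_incl_comp (hF : S.IsEvolutionMap U F) {x : D}
    (hx : x ∈ U) : ∀ᶠ z in 𝓝 x, ContMDiffAt 𝓘(ℝ, ED) 𝓘(ℝ, EV) ∞ (S.incl ∘ F) z := by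
  filter_upwards [hF.isOpen.mem_nhds hx] with z hz
  exact (S.contMDiff_incl (F z)).comp z (hF.contMDiffAt hz)

theorem IsEvolutionMap.extDerivOneForm_defect_eq_zero (hF : S.IsEvolutionMap U F) {x : D}
    (hx : x ∈ U) {a b : TangentSpace 𝓘(ℝ, ED) x} (ha : a ∈ S.KPlus x) (hb : b ∈ S.KPlus x)
    (hcurv : curvature S.KPlus x a b = 0) : extDerivOneForm (S.defect F) x a b = 0 := by
  obtain ⟨X₀, hX₀, hX₀a⟩ := S.exists_isLocalSection_KPlus ha
  obtain ⟨Y₀, hY₀, hY₀b⟩ := S.exists_isLocalSection_KPlus hb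
  -- With this, `hcurv` says that the bracket of the extensions chosen inside `curvature` lies in
  -- `𝒦⁺`. The argument below uses those same extensions, so independence of the choice is not
  -- needed.
  have h : ∃ XY : (∀ y : D, TangentSpace 𝓘(ℝ, ED) y) × (∀ y : D, TangentSpace 𝓘(ℝ, ED) y),
      IsLocalSection S.KPlus x XY.1 ∧ IsLocalSection S.KPlus x XY.2 ∧ XY.1 x = a ∧ XY.2 x = b :=
    ⟨(X₀, Y₀), hX₀, hY₀, hX₀a, hY₀b⟩
  rw [curvature, dif_pos h, neg_eq_zero, Submodule.mkQ_apply,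
    Submodule.Quotient.mk_eq_zero] at hcurv
  obtain ⟨hX, hY, hXa, hYb⟩ := h.choose_spec
  have hvan : ∀ {Z}, IsLocalSection S.KPlus x Z → ∀ᶠ z in 𝓝 x, S.defect F z (Z z) = 0 := by
    rintro Z ⟨W, hW, hxW, -, hZ⟩
    filter_upwards [hW.mem_nhds hxW, hF.isOpen.mem_nhds hx] with z hzW hzU
    exact hF.defect_apply_eq_zero hzU (hZ z hzW)
  have hdiff : DifferentiableAt ℝ (oneFormInChart (S.defect F) x) (extChartAt 𝓘(ℝ, ED) x x) :=
    (oneFormInChart_pullback_differentiableAt (Filter.Eventually.of_forall S.contMDiff_incl)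
      (S.differentiableAt_θPlus _)).sub
    (oneFormInChart_pullback_differentiableAt (hF.eventually_contMDiffAt_incl_comp hx)
      (S.differentiableAt_θMinus _))
  have := extDerivOneForm_eq_zero_of_annihilates hdiff hX.contMDiffAt hY.contMDiffAt
    (hvan hX) (hvan hY) (hF.defect_apply_eq_zero hx hcurv)
  rwa [hXa, hYb] at this

/-- On vectors of `𝒦⁺` on which its curvature vanishes, `F` pulls `ω⁻` back to `ω⁺`. -/
theorem IsEvolutionMap.ωMinus_mfderiv (hF : S.IsEvolutionMap U F) {x : D}
    (hx : x ∈ U) {a b : TangentSpace 𝓘(ℝ, ED) x} (ha : a ∈ S.KPlus x) (hb : b ∈ S.KPlus x)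
    (hcurv : curvature S.KPlus x a b = 0) :
    S.ωMinus (S.incl (F x)) (S.dIncl (F x) (mfderiv 𝓘(ℝ, ED) 𝓘(ℝ, ED) F x a))
        (S.dIncl (F x) (mfderiv 𝓘(ℝ, ED) 𝓘(ℝ, ED) F x b)) =
      S.ωPlus (S.incl x) (S.dIncl x a) (S.dIncl x b) := by
  have hi := Filter.Eventually.of_forall (f := 𝓝 x) S.contMDiff_incl
  have hiF := hF.eventually_contMDiffAt_incl_comp hx
  have h0 := hF.extDerivOneForm_defect_eq_zero hx ha hb hcurv
  have h1 := extDerivOneForm_sub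
    (oneFormInChart_pullback_differentiableAt hi (S.differentiableAt_θPlus _))
    (oneFormInChart_pullback_differentiableAt hiF (S.differentiableAt_θMinus _)) a b
  have h2 := h1.symm.trans h0
  rw [extDerivOneForm_pullback hi (S.differentiableAt_θPlus _),
    extDerivOneForm_pullback hiF (S.differentiableAt_θMinus _),
    mfderiv_comp x ((S.contMDiff_incl (F x)).mdifferentiableAt (by simp))
      ((hF.contMDiffAt hx).mdifferentiableAt (by simp)), sub_eq_zero] at h2
  exact congrArg Neg.neg h2.symm

end DCLS

end Discrete

end DiscreteLagrange

/-! ### Equality and preservation of the two-forms -/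

theorem mainTheorem5
    {EQ : Type*} [NormedAddCommGroup EQ] [NormedSpace ℝ EQ] [FiniteDimensional ℝ EQ]
    {Q : Type*} [TopologicalSpace Q] [ChartedSpace EQ Q] [IsManifold 𝓘(ℝ, EQ) ∞ Q]
    {EV : Type*} [NormedAddCommGroup EV] [NormedSpace ℝ EV] [FiniteDimensional ℝ EV]
    {V : Type*} [TopologicalSpace V] [ChartedSpace EV V] [IsManifold 𝓘(ℝ, EV) ∞ V]
    {ED : Type*} [NormedAddCommGroup ED] [NormedSpace ℝ ED] [FiniteDimensional ℝ ED]
    {D : Type*} [TopologicalSpace D] [ChartedSpace ED D] [IsManifold 𝓘(ℝ, ED) ∞ D]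
    (S : DiscreteLagrange.DCLS EQ Q EV V ED D)
    (U : Set D) (F : D → D) (hF : S.IsEvolutionMap U F)
    (D₀ : Set D) (K₀ : ∀ x : D, Submodule ℝ (TangentSpace 𝓘(ℝ, ED) x))
    (hK₀ : DiscreteLagrange.IsSmoothSubbundleOn (E := ED) (fun x : D => x) D₀ K₀)
    (hK₀_le : ∀ x ∈ D₀, K₀ x ≤ S.KPlus x)
    (h_inv : ∀ x ∈ D₀ ∩ U, F x ∈ D₀ ∧
      ∀ a ∈ K₀ x, mfderiv 𝓘(ℝ, ED) 𝓘(ℝ, ED) F x a ∈ K₀ (F x))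
    (h_curv : ∀ x ∈ D₀, ∀ a ∈ K₀ x, ∀ b ∈ K₀ x,
      DiscreteLagrange.curvature S.KPlus x a b = 0)
    (h_closed : ∀ x ∈ D₀, ∀ a ∈ K₀ x, ∀ b ∈ K₀ x,
      DiscreteLagrange.extDerivOneForm S.σ (S.incl x) (S.dIncl x a) (S.dIncl x b) = 0) :
    (∀ x ∈ D₀, ∀ a ∈ K₀ x, ∀ b ∈ K₀ x,
      S.ωPlus (S.incl x) (S.dIncl x a) (S.dIncl x b) =
        S.ωMinus (S.incl x) (S.dIncl x a) (S.dIncl x b)) ∧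
    (∀ x ∈ D₀ ∩ U, ∀ a ∈ K₀ x, ∀ b ∈ K₀ x,
      S.ωPlus (S.incl (F x))
          (S.dIncl (F x) (mfderiv 𝓘(ℝ, ED) 𝓘(ℝ, ED) F x a))
          (S.dIncl (F x) (mfderiv 𝓘(ℝ, ED) 𝓘(ℝ, ED) F x b)) =
        S.ωPlus (S.incl x) (S.dIncl x a) (S.dIncl x b)) ∧
    (∀ x ∈ D₀ ∩ U, ∀ a ∈ K₀ x, ∀ b ∈ K₀ x,
      S.ωMinus (S.incl (F x))
          (S.dIncl (F x) (mfderiv 𝓘(ℝ, ED) 𝓘(ℝ, ED) F x a))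
          (S.dIncl (F x) (mfderiv 𝓘(ℝ, ED) 𝓘(ℝ, ED) F x b)) =
        S.ωMinus (S.incl x) (S.dIncl x a) (S.dIncl x b)) := by
  have heq : ∀ x ∈ D₀, ∀ a ∈ K₀ x, ∀ b ∈ K₀ x,
      S.ωPlus (S.incl x) (S.dIncl x a) (S.dIncl x b) =
        S.ωMinus (S.incl x) (S.dIncl x a) (S.dIncl x b) :=
    fun x hx a ha b hb => S.ωPlus_eq_ωMinus (h_closed x hx a ha b hb)
  -- This relates `ω⁻` at `F x` to `ω⁺` at `x`. Each conclusion needs one exchange of sign: at `F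
  -- x`, where invariance of `K₀` is used, for `ω⁺`, and at `x` for `ω⁻`.
  have hpull := fun x (hx : x ∈ D₀ ∩ U) a (ha : a ∈ K₀ x) b (hb : b ∈ K₀ x) =>
    hF.ωMinus_mfderiv hx.2 (hK₀_le x hx.1 ha) (hK₀_le x hx.1 hb) (h_curv x hx.1 a ha b hb)
  refine ⟨heq, fun x hx a ha b hb => ?_, fun x hx a ha b hb => ?_⟩
  · obtain ⟨hFx, hFK⟩ := h_inv x hx
    rw [heq (F x) hFx _ (hFK a ha) _ (hFK b hb)]
    exact hpull x hx a ha b hb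
  · exact (hpull x hx a ha b hb).trans (heq x hx.1 a ha b hb)
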